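/- Let $k \ge 1$ be an integer, let $\Sigma$ be a fixed (known) positive definite $k\times k$ matrix, and let $0<d<1$; $k,\Sigma,d$ do not depend on $n$. Write $\lVert x\rVert_\Sigma^2 = x^T\Sigma^{-1}x$ for the squared Mahalanobis norm. Let $X_1,\dots,X_n$ be independent with $X_i\sim N_k(\theta_{0i},\Sigma)$. Let $(q_n)$ be a sequence of positive integers with $q_n=o(n)$, and let $$L_0[q_n]=\Bigl\{\{\theta_{0i}\}_{i=1}^n\subset\mathbb R^k:\ \#\{i:\theta_{0i}\ne 0\}\le q_n\Bigr\}$$ be the set of nearly-black mean configurations. Consider the Exponential-Inverse-Gamma prior: independently over $i$, $\theta_i\mid\lambda_i^2,\tau_i\sim N_k(0,\lambda_i^2\tau_i\Sigma)$, where $\lambda_i^2$ and $\tau_i$ are independent, $\lambda_i^2\sim\mathrm{Exp}(1/2)$ (density $\propto e^{-\lambda_i^2/2}$ on $(0,\infty)$) and $\tau_i\sim\mathrm{InvGamma}(d,c_n/2)$ (density $\propto \tau_i^{-d-1}e^{-c_n/(2\tau_i)}$ on $(0,\infty)$), with $$c_n=\left(\frac{q_n}{n}\right)^{(1+\epsilon_n)/d},\qquad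 \epsilon_n=\frac1{\log\log(n/q_n)}$$ (defined for all sufficiently large $n$). Let $\widehat\theta_i=E(\theta_i\mid X_i)$ be the posterior mean. Then, as $n\to\infty$, $$\lim_{n\to\infty}\ \sup_{\{\theta_{0i}\}\in L_0[q_n]}\ \frac{\sum_{i:\theta_{0i}=0}E_{0}\lVert\widehat\theta_i\rVert_\Sigma^2}{q_n\log(n/q_n)}=0,$$ $$\limsup_{n\to\infty}\ \sup_{\{\theta_{0i}\}\in L_0[q_n]}\ \frac{\sum_{i:\theta_{0i}\neq0}E_{\theta_{0i}}\lVert\widehat\theta_i-\theta_{0i}\rVert_\Sigma^2}{2q_n\log(n/q_n)}\le 1,$$ $$\lim_{n\to\infty}\ \sup_{\{\theta_{0i}\}\in L_0[q_n]}\ \frac{\sum_{i=1}^nE_{\theta_{0i}}\lVert\widehat\theta_i-\theta_{0i}\rVert_\Sigma^2}{2q_n\log(n/q_n)}=1.$$ Thus the estimator attains the exact asymptotic minimax risk over $L_0[q_n]$, which is $$\inf_{\widetilde\theta}\ \sup_{\{\theta_{0i}\}\in L_0[q_n]}\ \sum_{i=1}^nE\lVert\widetilde\theta_i-\theta_{0i}\rVert_\Sigma^2=2q_n\log(n/q_n)\,(1+o(1)),$$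 the infimum being over all (measurable) estimators $\widetilde\theta=(\widetilde\theta_1,\dots,\widetilde\theta_n)$ based on $X_1,\dots,X_n$. -/

import Mathlib

open MeasureTheory ProbabilityTheory Filter Topology
open scoped ENNReal Matrix

noncomputable section

namespace SparseNormalMeans

/-- The squared Mahalanobis norm `xᵀ S⁻¹ x`. -/
def mahalSq {k : ℕ} (S : Matrix (Fin k) (Fin k) ℝ) (x : EuclideanSpace ℝ (Fin k)) : ℝ :=
  x.ofLp ⬝ᵥ (S⁻¹ *ᵥ x.ofLp)

/-- The Lebesgue density at `x` of the normal distribution with mean `θ` and positive definite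
covariance matrix `S`. -/
def normalDensity {k : ℕ} (S : Matrix (Fin k) (Fin k) ℝ) (θ x : EuclideanSpace ℝ (Fin k)) : ℝ :=
  (Real.sqrt ((2 * Real.pi) ^ k * S.det))⁻¹ * Real.exp (-(mahalSq S (x - θ)) / 2)

/-- The inverse gamma distribution with shape `a` and scale `b`. -/
def invGammaMeasure (a b : ℝ) : Measure ℝ :=
  volume.withDensity fun t ↦ ENNReal.ofReal
    (if 0 < t then b ^ a / Real.Gamma a * t ^ (-a - 1) * Real.exp (-b / t) else 0)

/-- The joint distribution of the local scale `λ²` and the global scale `τ`: independent,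
`λ² ∼ Exp(1/2)` and `τ ∼ InvGamma(d, c/2)`. -/
def scalePrior (d c : ℝ) : Measure (ℝ × ℝ) :=
  (expMeasure (1 / 2)).prod (invGammaMeasure d (c / 2))

/-- The Exponential-Inverse-Gamma prior of one mean vector: given `(λ², τ)` it is
`N_k(0, λ² τ S)`. -/
def eigPrior {k : ℕ} (S : Matrix (Fin k) (Fin k) ℝ) (d c : ℝ) :
    Measure (EuclideanSpace ℝ (Fin k)) :=
  (scalePrior d c).bind fun p ↦ multivariateGaussian 0 ((p.1 * p.2) • S)

/-- A rescaled centred normal vector has the rescaled covariance matrix. -/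
theorem multivariateGaussian_smul {k : ℕ} {S : Matrix (Fin k) (Fin k) ℝ} (hS : S.PosDef)
    {u : ℝ} (hu : 0 ≤ u) :
    multivariateGaussian 0 (u • S) =
      (multivariateGaussian 0 S).map (fun x ↦ Real.sqrt u • x) := by
  apply Measure.ext_of_charFun
  ext t
  rw [charFun_multivariateGaussian (hS.posSemidef.smul hu), charFun_map_smul,
    charFun_multivariateGaussian hS.posSemidef]
  congr 1
  simp only [inner_zero_right, WithLp.ofLp_smul, Matrix.mulVec_smul, Matrix.smul_mulVec,
    dotProduct_smul, smul_dotProduct, smul_eq_mul]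
  rw [← mul_assoc, Real.mul_self_sqrt hu]

/-- The conditional distribution of the mean vector given the scales is a measurable family, so
that the mixture defining the prior is a genuine one. -/
theorem measurable_conditionalPrior {k : ℕ} {S : Matrix (Fin k) (Fin k) ℝ} (hS : S.PosDef) :
    Measurable fun p : ℝ × ℝ ↦
      multivariateGaussian (0 : EuclideanSpace ℝ (Fin k)) ((p.1 * p.2) • S) := by
  have key : (fun p : ℝ × ℝ ↦
      multivariateGaussian (0 : EuclideanSpace ℝ (Fin k)) ((p.1 * p.2) • S)) =
      fun p ↦ (multivariateGaussian (0 : EuclideanSpace ℝ (Fin k)) S).map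
        (fun x ↦ Real.sqrt (p.1 * p.2) • x) := by
    funext p
    rcases le_or_gt 0 (p.1 * p.2) with h | h
    · exact multivariateGaussian_smul hS h
    rw [Real.sqrt_eq_zero_of_nonpos h.le]
    rcases isEmpty_or_nonempty (Fin k) with hk | ⟨⟨j⟩⟩
    · rw [← Real.sqrt_zero, ← multivariateGaussian_smul hS le_rfl]
      congr 1
      exact Subsingleton.elim _ _
    · rw [multivariateGaussian_of_not_posSemidef]
      · simp [Measure.map_const]
      · intro hps
        have h1 := hps.diag_nonneg (i := j)
        have h2 := hS.diag_pos (i := j)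
        simp only [Matrix.smul_apply, smul_eq_mul] at h1
        nlinarith
  rw [key]
  refine Measure.measurable_of_measurable_coe _ fun s hs ↦ ?_
  have hm : Measurable fun z : (ℝ × ℝ) × EuclideanSpace ℝ (Fin k) ↦
      Real.sqrt (z.1.1 * z.1.2) • z.2 := by fun_prop
  have h := measurable_measure_prodMk_left
    (ν := multivariateGaussian (0 : EuclideanSpace ℝ (Fin k)) S) (hm hs)
  convert h using 2 with p
  rw [Measure.map_apply (by fun_prop) hs]
  rfl

/-- The posterior mean `E(θ | X = x)` of one mean vector `θ` with the
Exponential-Inverse-Gamma prior, given one observation `X | θ ∼ N_k(θ, S)`, by Bayes' formula. -/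
def eigPosteriorMean {k : ℕ} (S : Matrix (Fin k) (Fin k) ℝ) (d c : ℝ)
    (x : EuclideanSpace ℝ (Fin k)) : EuclideanSpace ℝ (Fin k) :=
  (∫ θ, normalDensity S θ x ∂(eigPrior S d c))⁻¹ •
    ∫ θ, normalDensity S θ x • θ ∂(eigPrior S d c)

/-- The estimator of `n` mean vectors by their posterior means. -/
def eigEstimator {k : ℕ} (S : Matrix (Fin k) (Fin k) ℝ) (d c : ℝ) (n : ℕ)
    (X : Fin n → EuclideanSpace ℝ (Fin k)) : Fin n → EuclideanSpace ℝ (Fin k) :=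
  fun i ↦ eigPosteriorMean S d c (X i)

/-- The nearly black mean configurations: at most `q` of the `n` mean vectors are nonzero. -/
def nearlyBlack (k n q : ℕ) : Set (Fin n → EuclideanSpace ℝ (Fin k)) :=
  {θ | {i | θ i ≠ 0}.ncard ≤ q}

/-- The law of independent observations `X_i ∼ N_k(θ_i, S)`. -/
def dataLaw {k n : ℕ} (S : Matrix (Fin k) (Fin k) ℝ) (θ : Fin n → EuclideanSpace ℝ (Fin k)) :
    Measure (Fin n → EuclideanSpace ℝ (Fin k)) :=
  Measure.pi fun i ↦ multivariateGaussian (θ i) S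

/-- The risk of the estimator `T` for the `i`-th mean vector, at the true means `θ`, under the
squared Mahalanobis loss. -/
def coordRisk {k n : ℕ} (S : Matrix (Fin k) (Fin k) ℝ)
    (T : (Fin n → EuclideanSpace ℝ (Fin k)) → (Fin n → EuclideanSpace ℝ (Fin k)))
    (θ : Fin n → EuclideanSpace ℝ (Fin k)) (i : Fin n) : ℝ≥0∞ :=
  ∫⁻ X, ENNReal.ofReal (mahalSq S (T X i - θ i)) ∂(dataLaw S θ)

open Classical in
/-- The part of the risk that comes from the zero means. -/
def zeroRisk {k n : ℕ} (S : Matrix (Fin k) (Fin k) ℝ)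
    (T : (Fin n → EuclideanSpace ℝ (Fin k)) → (Fin n → EuclideanSpace ℝ (Fin k)))
    (θ : Fin n → EuclideanSpace ℝ (Fin k)) : ℝ≥0∞ :=
  ∑ i with θ i = 0, coordRisk S T θ i

open Classical in
/-- The part of the risk that comes from the nonzero means. -/
def nonzeroRisk {k n : ℕ} (S : Matrix (Fin k) (Fin k) ℝ)
    (T : (Fin n → EuclideanSpace ℝ (Fin k)) → (Fin n → EuclideanSpace ℝ (Fin k)))
    (θ : Fin n → EuclideanSpace ℝ (Fin k)) : ℝ≥0∞ :=
  ∑ i with θ i ≠ 0, coordRisk S T θ i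

/-- The total risk. -/
def totalRisk {k n : ℕ} (S : Matrix (Fin k) (Fin k) ℝ)
    (T : (Fin n → EuclideanSpace ℝ (Fin k)) → (Fin n → EuclideanSpace ℝ (Fin k)))
    (θ : Fin n → EuclideanSpace ℝ (Fin k)) : ℝ≥0∞ :=
  ∑ i, coordRisk S T θ i

/-- The minimax risk over the nearly black mean configurations: the infimum is over all
estimators, each of which may use all the observations. -/
def minimaxRisk {k : ℕ} (S : Matrix (Fin k) (Fin k) ℝ) (n q : ℕ) : ℝ≥0∞ :=
  ⨅ (T : (Fin n → EuclideanSpace ℝ (Fin k)) → (Fin n → EuclideanSpace ℝ (Fin k)))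
    (_ : Measurable T), ⨆ θ ∈ nearlyBlack k n q, totalRisk S T θ

/-- The tuning sequence `ε_n = 1 / log log (n / q_n)`, as a function of `n` and `q = q_n`. -/
def tuningEps (n q : ℕ) : ℝ := 1 / Real.log (Real.log ((n : ℝ) / q))

/-- The scale `c_n = (q_n / n) ^ ((1 + ε_n) / d)`, as a function of `n` and `q = q_n`. -/
def tuningScale (d : ℝ) (n q : ℕ) : ℝ := ((q : ℝ) / n) ^ ((1 + tuningEps n q) / d)

end SparseNormalMeans

end

open SparseNormalMeans

/-! Write `L = log (n/q)`. A linear change of variables by the square root of `S` turns the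
Mahalanobis norm into the Euclidean norm and the observations into standard normal vectors shifted
by their means. The prior then depends on the scales only through `u = λ² τ`, whose law has density
proportional to `(u + c)^(-d-1)`. Given `u`, the posterior mean is `u/(1+u)` times the observation,
so the estimator is a radial shrinkage `κ(‖y‖²) y` with `κ` the posterior average of `u/(1+u)`
(`eigPosteriorMean_map`).

Upper bound. Two estimates of `κ` suffice. The prior mass near `u ≈ c` gives `κ(s) ≤ C c^d e^(s/2)`
(`exists_shrinkFactor_le`), so a zero mean costs about `c^d` times a power of `L`, plus `e^(-L)`.
Since `c^d = (q/n) e^(-L/log L)`, and `e^(-L/log L)` beats any power of `L`, all zero means together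
cost `O(q) = o(q L)`. The polynomial tail of the law of `u` gives `(1-κ(s))² s ≤ C + 2(1+δ)²
log(c^(-d))` (`exists_one_sub_shrinkFactor_sq_mul_le`): an observation is shrunk substantially only
below the threshold `s ≈ 2 log(c^(-d)) ≈ 2L`. The error at a nonzero mean is noise minus `(1-κ)`
times the observation, so such a mean costs at most `(1+o(1)) 2L`.

Lower bound. Take `q` disjoint blocks of `m = ⌊n/q⌋` places and put one vector of length `a = α √(2
log m)`, `α < 1`, at a uniformly random place of each block. The Bayes risk of a block is at least
`a²` times one minus the expected posterior probability of the true place (`sum_risk_spike_ge`).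
That probability tends to zero, because the largest of the pure noise projections exceeds the
projection of the true spike by a multiple of `√(log m)` (`lintegral_spikePosterior_le`,
`tendsto_spikeBound`). Letting `α → 1` gives minimax risk at least `(1-o(1)) 2 q L`.

The minimax risk is at most the worst risk of the estimator, so the two bounds sandwich both
quantities and yield the last two limits together. -/

namespace SparseNormalMeans

/-! ### Reduction to identity covariance. -/

section Whitening

open scoped MatrixOrder

/-- A positive definite matrix has an invertible square root, which maps the standard normal
distribution to the normal distributions with this covariance matrix. -/
theorem exists_whitening {k : ℕ} {S : Matrix (Fin k) (Fin k) ℝ} (hS : S.PosDef) :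
    ∃ A : EuclideanSpace ℝ (Fin k) ≃L[ℝ] EuclideanSpace ℝ (Fin k),
      (∀ x, mahalSq S (A x) = ‖x‖ ^ 2) ∧
      ∀ v, multivariateGaussian (A v) S =
        (stdGaussian (EuclideanSpace ℝ (Fin k))).map (fun x ↦ A (v + x)) := by
  set R : Matrix (Fin k) (Fin k) ℝ := CFC.sqrt S with hR
  have hRR : R * R = S := CFC.sqrt_mul_sqrt_self S hS.posSemidef.nonneg
  have hRH : Rᵀ = R := by
    have := (CFC.sqrt_nonneg S).isSelfAdjoint
    simpa [IsSelfAdjoint, Matrix.star_eq_conjTranspose] using this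
  have hdet : IsUnit R.det := by
    have h := hS.det_pos
    rw [← hRR, Matrix.det_mul] at h
    exact isUnit_iff_ne_zero.2 fun h0 ↦ by simp [h0] at h
  -- This identity turns the quadratic form of `S⁻¹` at `R x` into `‖x‖²`.
  have hinv : R * S⁻¹ * R = 1 := by
    rw [← hRR, Matrix.mul_inv_rev, ← mul_assoc, Matrix.mul_nonsing_inv _ hdet, one_mul,
      Matrix.nonsing_inv_mul _ hdet]
  let B := Matrix.toEuclideanCLM (𝕜 := ℝ) R
  let B' := Matrix.toEuclideanCLM (𝕜 := ℝ) R⁻¹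
  have h1 : ∀ x, B' (B x) = x := fun x ↦ by
    have : B' * B = 1 := by
      rw [← map_mul, Matrix.nonsing_inv_mul _ hdet, map_one]
    exact congrArg (fun f ↦ f x) this
  have h2 : ∀ x, B (B' x) = x := fun x ↦ by
    have : B * B' = 1 := by
      rw [← map_mul, Matrix.mul_nonsing_inv _ hdet, map_one]
    exact congrArg (fun f ↦ f x) this
  let A : EuclideanSpace ℝ (Fin k) ≃L[ℝ] EuclideanSpace ℝ (Fin k) :=
    ContinuousLinearEquiv.equivOfInverse B B' h1 h2
  have hA : ∀ x, A x = B x := fun _ ↦ rfl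
  refine ⟨A, fun x ↦ ?_, fun v ↦ ?_⟩
  · have e : (A x).ofLp = R *ᵥ x.ofLp := by rw [hA]; exact Matrix.ofLp_toEuclideanCLM ..
    rw [mahalSq, e, Matrix.dotProduct_mulVec, Matrix.vecMul_mulVec, hRH, ← Matrix.dotProduct_mulVec,
      Matrix.mulVec_mulVec, hinv, Matrix.one_mulVec, EuclideanSpace.real_norm_sq_eq]
    simp [dotProduct, sq]
  · rw [multivariateGaussian]
    congr 1
    funext x
    rw [map_add]
    rfl

end Whitening

/-! ### Density, exponential moments and shifts of the standard normal distribution. -/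

section StdGaussian

variable {E : Type*} [NormedAddCommGroup E] [InnerProductSpace ℝ E]

/-- The Lebesgue density of the standard normal distribution of a Euclidean space. -/
noncomputable def stdDensity (x : E) : ℝ :=
  (2 * Real.pi) ^ (-(Module.finrank ℝ E / 2 : ℝ)) * Real.exp (-‖x‖ ^ 2 / 2)

theorem continuous_stdDensity : Continuous (stdDensity (E := E)) := by
  unfold stdDensity; fun_prop

theorem stdDensity_nonneg (x : E) : 0 ≤ stdDensity x := by
  unfold stdDensity; positivity

variable [FiniteDimensional ℝ E] [MeasurableSpace E] [BorelSpace E]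

theorem integrable_exp_neg_mul_norm_sq {b : ℝ} (hb : 0 < b) :
    Integrable (fun x : E ↦ Real.exp (-b * ‖x‖ ^ 2)) := by
  have h := (GaussianFourier.integrable_cexp_neg_mul_sq_norm_add (V := E) (b := b)
    (by simpa using hb) 0 0).norm
  refine h.congr (ae_of_all _ fun x ↦ ?_)
  simp only [zero_mul, add_zero]
  rw [← Complex.ofReal_pow, ← Complex.ofReal_neg, ← Complex.ofReal_mul, Complex.norm_exp_ofReal]

theorem integrable_stdDensity : Integrable (stdDensity (E := E)) := by
  refine ((integrable_exp_neg_mul_norm_sq (E := E) (b := 1 / 2) (by norm_num)).const_mul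
    ((2 * Real.pi) ^ (-(Module.finrank ℝ E / 2 : ℝ)))).congr (ae_of_all _ fun x ↦ ?_)
  simp only [stdDensity]
  ring_nf

/-- The two characteristic functions agree, by the complex Gaussian integral with linear term `I *
inner t x`. -/
theorem stdGaussian_eq_withDensity :
    stdGaussian E = volume.withDensity fun x ↦ ENNReal.ofReal (stdDensity x) := by
  have hfin : IsFiniteMeasure (volume.withDensity fun x : E ↦ ENNReal.ofReal (stdDensity x)) :=
    isFiniteMeasure_withDensity_ofReal integrable_stdDensity.hasFiniteIntegral
  apply Measure.ext_of_charFun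
  ext t
  rw [charFun_stdGaussian, charFun_apply,
    integral_withDensity_eq_integral_toReal_smul₀ (by
      have := (continuous_stdDensity (E := E)).measurable; fun_prop) (by simp)]
  have h := GaussianFourier.integral_cexp_neg_mul_sq_norm_add (V := E) (b := 1 / 2)
    (by norm_num) Complex.I t
  have e : ∀ x : E, (ENNReal.ofReal (stdDensity x)).toReal • Complex.exp (inner ℝ x t * Complex.I) =
      ((2 * Real.pi) ^ (-(Module.finrank ℝ E / 2 : ℝ)) : ℝ) *
        Complex.exp (-(1 / 2) * ‖x‖ ^ 2 + Complex.I * inner ℝ t x) := fun x ↦ by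
    rw [ENNReal.toReal_ofReal (stdDensity_nonneg x), stdDensity, Complex.real_smul,
      Complex.ofReal_mul, mul_assoc, Complex.ofReal_exp, ← Complex.exp_add, real_inner_comm]
    congr 2
    push_cast
    ring
  simp_rw [e]
  rw [integral_const_mul, h, ← mul_assoc]
  have hc : (((2 * Real.pi) ^ (-(Module.finrank ℝ E / 2 : ℝ)) : ℝ) : ℂ) *
      (Real.pi / (1 / 2 : ℂ)) ^ (Module.finrank ℝ E / 2 : ℂ) = 1 := by
    have : (Real.pi / (1 / 2 : ℂ)) ^ (Module.finrank ℝ E / 2 : ℂ) =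
        (((2 * Real.pi) ^ ((Module.finrank ℝ E / 2 : ℝ)) : ℝ) : ℂ) := by
      rw [Complex.ofReal_cpow (by positivity)]
      congr 1
      · push_cast; ring
      · push_cast; ring
    rw [this, ← Complex.ofReal_mul, ← Real.rpow_add (by positivity)]
    simp
  rw [hc, one_mul]
  congr 1
  rw [Complex.I_sq]
  ring

theorem lintegral_stdGaussian {f : E → ℝ≥0∞} (hf : Measurable f) :
    ∫⁻ x, f x ∂stdGaussian E = ∫⁻ x, ENNReal.ofReal (stdDensity x) * f x := by
  rw [stdGaussian_eq_withDensity, lintegral_withDensity_eq_lintegral_mul _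
    (continuous_stdDensity.measurable.ennreal_ofReal) hf]
  rfl

/-- The moment generating function of the squared norm of a standard normal vector. -/
theorem lintegral_exp_norm_sq_stdGaussian {a : ℝ} (ha : a < 1) :
    ∫⁻ x, ENNReal.ofReal (Real.exp (a * ‖x‖ ^ 2 / 2)) ∂stdGaussian E =
      ENNReal.ofReal ((1 - a) ^ (-(Module.finrank ℝ E / 2 : ℝ))) := by
  have ha' : 0 < (1 - a) / 2 := by linarith
  have ha1 : 0 < 1 - a := by linarith
  rw [lintegral_stdGaussian (by fun_prop)]
  have e : ∀ x : E, ENNReal.ofReal (stdDensity x) * ENNReal.ofReal (Real.exp (a * ‖x‖ ^ 2 / 2)) =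
      ENNReal.ofReal ((2 * Real.pi) ^ (-(Module.finrank ℝ E / 2 : ℝ)) *
        Real.exp (-((1 - a) / 2) * ‖x‖ ^ 2)) := fun x ↦ by
    rw [← ENNReal.ofReal_mul (stdDensity_nonneg x), stdDensity, mul_assoc, ← Real.exp_add]
    congr 3
    ring
  simp_rw [e]
  rw [← ofReal_integral_eq_lintegral_ofReal ((integrable_exp_neg_mul_norm_sq ha').const_mul _)
    (ae_of_all _ fun x ↦ by positivity), integral_const_mul,
    GaussianFourier.integral_rexp_neg_mul_sq_norm ha']
  congr 1
  rw [show Real.pi / ((1 - a) / 2) = (2 * Real.pi) * (1 - a)⁻¹ by field_simp,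
    Real.mul_rpow (x := 2 * Real.pi) (by positivity) (by positivity), ← mul_assoc,
    ← Real.rpow_add (by positivity), neg_add_cancel, Real.rpow_zero, one_mul,
    Real.inv_rpow ha1.le, Real.rpow_neg ha1.le]

/-- The likelihood ratio of a shift of the standard normal distribution. -/
theorem stdGaussian_map_add_left (v : E) :
    (stdGaussian E).map (fun x ↦ v + x) = (stdGaussian E).withDensity
      fun x ↦ ENNReal.ofReal (Real.exp (inner ℝ v x - ‖v‖ ^ 2 / 2)) := by
  ext s hs
  rw [Measure.map_apply (by fun_prop) hs, withDensity_apply _ hs,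
    ← lintegral_indicator_one (hs.preimage (by fun_prop)), ← lintegral_indicator hs,
    lintegral_stdGaussian (measurable_one.indicator (hs.preimage (by fun_prop))),
    lintegral_stdGaussian ((by fun_prop : Measurable _).indicator hs),
    ← lintegral_add_left_eq_self (μ := (volume : Measure E)) _ (-v)]
  refine lintegral_congr fun x ↦ ?_
  by_cases hx : x ∈ s
  · rw [Set.indicator_of_mem (show -v + x ∈ (fun x ↦ v + x) ⁻¹' s by simpa using hx),
      Set.indicator_of_mem hx, ← ENNReal.ofReal_mul (stdDensity_nonneg _), Pi.one_apply, mul_one]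
    congr 1
    rw [stdDensity, stdDensity, mul_assoc, ← Real.exp_add]
    congr 2
    rw [@norm_add_sq_real, inner_neg_left, norm_neg]
    ring
  · rw [Set.indicator_of_notMem (show -v + x ∉ (fun x ↦ v + x) ⁻¹' s by simpa using hx),
      Set.indicator_of_notMem hx, mul_zero, mul_zero]

end StdGaussian

end SparseNormalMeans

namespace SparseNormalMeans

/-! ### The law of the product of the local and the global scale. -/

section ScaleLaw

/-- The integral of the inverse gamma density. -/
theorem lintegral_rpow_mul_exp_neg_div {p b : ℝ} (hp : 0 < p) (hb : 0 < b) :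
    ∫⁻ t in Set.Ioi 0, ENNReal.ofReal (t ^ (-p - 1) * Real.exp (-b / t)) =
      ENNReal.ofReal (Real.Gamma p * b ^ (-p)) := by
  have h1 := Real.integral_rpow_mul_exp_neg_mul_Ioi hp hb
  -- The substitution `t ↦ t⁻¹` carries the Gamma integral to the inverse gamma one.
  rw [← integral_comp_rpow_Ioi _ (show (-1 : ℝ) ≠ 0 by norm_num)] at h1
  have h2 : ∫ t in Set.Ioi 0, t ^ (-p - 1) * Real.exp (-b / t) = Real.Gamma p * b ^ (-p) := by
    rw [mul_comm, Real.rpow_neg hb.le, ← Real.inv_rpow hb.le, ← one_div, ← h1]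
    refine setIntegral_congr_fun measurableSet_Ioi fun t (ht : 0 < t) ↦ ?_
    simp only [smul_eq_mul, abs_neg, abs_one, one_mul]
    rw [← mul_assoc, ← Real.rpow_mul ht.le, ← Real.rpow_add ht, Real.rpow_neg_one]
    congr 2
    · ring
    · rw [neg_div, div_eq_mul_inv]
  have hpos : 0 < Real.Gamma p * b ^ (-p) := mul_pos (Real.Gamma_pos_of_pos hp) (by positivity)
  rw [← h2, ofReal_integral_eq_lintegral_ofReal]
  -- A non-integrable function has Bochner integral zero by convention, so a nonzero value proves
  -- integrability.
  · exact Integrable.of_integral_ne_zero (h2 ▸ hpos.ne')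
  · filter_upwards [ae_restrict_mem measurableSet_Ioi] with t ht
    have : 0 < t := ht
    simp only [Pi.zero_apply]
    positivity

theorem lintegral_Ioi_comp_mul_right {t : ℝ} (ht : 0 < t) (f : ℝ → ℝ≥0∞) :
    ∫⁻ u in Set.Ioi 0, f u = ∫⁻ x in Set.Ioi 0, ENNReal.ofReal t * f (x * t) := by
  have h := lintegral_image_eq_lintegral_abs_deriv_mul (s := Set.Ioi (0 : ℝ))
    (f := fun x ↦ x * t) (f' := fun _ ↦ t) measurableSet_Ioi
    (fun x _ ↦ by simpa using ((hasDerivAt_id x).mul_const t).hasDerivWithinAt)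
    (fun x _ y _ hxy ↦ by simpa [ht.ne'] using hxy) f
  have himg : (fun x ↦ x * t) '' Set.Ioi (0 : ℝ) = Set.Ioi 0 := by
    ext y
    simp only [Set.mem_image, Set.mem_Ioi]
    exact ⟨fun ⟨x, hx, hy⟩ ↦ hy ▸ mul_pos hx ht, fun hy ↦ ⟨y / t, by positivity, by field_simp⟩⟩
  rw [himg, abs_of_pos ht] at h
  exact h

theorem lintegral_expMeasure {r : ℝ} {f : ℝ → ℝ≥0∞} (hf : Measurable f) :
    ∫⁻ x, f x ∂expMeasure r =
      ∫⁻ x in Set.Ioi 0, ENNReal.ofReal (r * Real.exp (-(r * x))) * f x := by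
  have e : expMeasure r = volume.withDensity (exponentialPDF r) := rfl
  have hm : Measurable (exponentialPDF r) := (measurable_exponentialPDFReal r).ennreal_ofReal
  rw [e, lintegral_withDensity_eq_lintegral_mul _ hm hf, ← lintegral_indicator measurableSet_Ioi]
  refine lintegral_congr_ae ?_
  filter_upwards [compl_mem_ae_iff.2 (measure_singleton (0 : ℝ))] with x hx
  rcases lt_trichotomy x 0 with h | h | h
  · simp [exponentialPDF_of_neg h, h.le]
  · exact absurd h hx
  · simp [exponentialPDF_of_nonneg h.le, h]

theorem lintegral_invGammaMeasure {a b : ℝ} {f : ℝ → ℝ≥0∞} (hf : Measurable f) :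
    ∫⁻ t, f t ∂invGammaMeasure a b = ∫⁻ t in Set.Ioi 0,
      ENNReal.ofReal (b ^ a / Real.Gamma a * t ^ (-a - 1) * Real.exp (-b / t)) * f t := by
  rw [invGammaMeasure, lintegral_withDensity_eq_lintegral_mul _ _ hf,
    ← lintegral_indicator measurableSet_Ioi]
  · refine lintegral_congr fun t ↦ ?_
    by_cases h : 0 < t <;> simp [h]
  · refine Measurable.ennreal_ofReal (Measurable.ite measurableSet_Ioi ?_ measurable_const)
    fun_prop

instance sFinite_invGammaMeasure (a b : ℝ) : SFinite (invGammaMeasure a b) := by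
  unfold invGammaMeasure; infer_instance

/-- The measure `(u + c)^(-d-1) du` on the positive half-line. -/
noncomputable def lomaxMeasure (d c : ℝ) : Measure ℝ :=
  (volume.restrict (Set.Ioi 0)).withDensity fun u ↦ ENNReal.ofReal ((u + c) ^ (-d - 1))

theorem lintegral_lomaxMeasure {d c : ℝ} {f : ℝ → ℝ≥0∞} (hf : Measurable f) :
    ∫⁻ u, f u ∂lomaxMeasure d c =
      ∫⁻ u in Set.Ioi 0, ENNReal.ofReal ((u + c) ^ (-d - 1)) * f u := by
  rw [lomaxMeasure, lintegral_withDensity_eq_lintegral_mul _ (by fun_prop) hf]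
  rfl

/-- For fixed `τ = t` the substitution `u = x t` gives the product the density `e^(-u/(2t)) / (2t)`.
Multiplied by the inverse gamma density this is an inverse gamma kernel of shape `d + 1` and scale
`(u + c)/2`, and integrating out `t` leaves a multiple of `(u + c)^(-d-1)`. The constants collapse
to `d c^d` through `Γ(d+1) = d Γ(d)`. -/
theorem lintegral_scalePrior {d c : ℝ} (hd : 0 < d) (hc : 0 < c) {f : ℝ → ℝ≥0∞}
    (hf : Measurable f) :
    ∫⁻ p, f (p.1 * p.2) ∂scalePrior d c =
      ENNReal.ofReal (d * c ^ d) * ∫⁻ u, f u ∂lomaxMeasure d c := by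
  have := isProbabilityMeasure_expMeasure (r := 1 / 2) (by norm_num)
  set C := (c / 2) ^ d / Real.Gamma d with hC
  have hG := Real.Gamma_pos_of_pos hd
  have hC0 : 0 < C := by positivity
  rw [scalePrior, lintegral_prod_symm' _ (by fun_prop), lintegral_invGammaMeasure
    ((by fun_prop : Measurable fun p : ℝ × ℝ ↦ f (p.2 * p.1)).lintegral_prod_right')]
  have inner : ∀ t ∈ Set.Ioi (0 : ℝ),
      ENNReal.ofReal (C * t ^ (-d - 1) * Real.exp (-(c / 2) / t)) *
        ∫⁻ x, f (x * t) ∂expMeasure (1 / 2) =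
      ∫⁻ u in Set.Ioi 0, ENNReal.ofReal (C / 2) *
        (ENNReal.ofReal (t ^ (-(d + 1) - 1) * Real.exp (-((u + c) / 2) / t)) * f u) := by
    intro t (ht : 0 < t)
    rw [lintegral_expMeasure (by fun_prop),
      lintegral_Ioi_comp_mul_right ht (fun u ↦ ENNReal.ofReal (C / 2) * _),
      ← lintegral_const_mul _ (by fun_prop)]
    refine setLIntegral_congr_fun measurableSet_Ioi fun x (hx : 0 < x) ↦ ?_
    rw [← mul_assoc, ← mul_assoc, ← mul_assoc, ← ENNReal.ofReal_mul (by positivity),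
      ← ENNReal.ofReal_mul (by positivity), ← ENNReal.ofReal_mul (by positivity)]
    congr 2
    have e1 : t ^ (-(d + 1) - 1) = t ^ (-d - 1) * t⁻¹ := by
      rw [← Real.rpow_neg_one t, ← Real.rpow_add ht]; ring_nf
    have e2 : Real.exp (-((x * t + c) / 2) / t) =
        Real.exp (-(c / 2) / t) * Real.exp (-(1 / 2 * x)) := by
      rw [← Real.exp_add]; congr 1; field_simp; ring
    rw [e1, e2]
    field_simp
  rw [setLIntegral_congr_fun measurableSet_Ioi inner, lintegral_lintegral_swap (by fun_prop),
    lintegral_lomaxMeasure hf, ← lintegral_const_mul _ (by fun_prop)]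
  refine setLIntegral_congr_fun measurableSet_Ioi fun u (hu : 0 < u) ↦ ?_
  rw [lintegral_const_mul _ (by fun_prop), lintegral_mul_const _ (by fun_prop),
    lintegral_rpow_mul_exp_neg_div (by linarith) (by positivity), ← mul_assoc, ← mul_assoc,
    ← ENNReal.ofReal_mul (by positivity), ← ENNReal.ofReal_mul (by positivity)]
  congr 2
  rw [hC, Real.Gamma_add_one hd.ne', Real.div_rpow (x := c) hc.le (by norm_num),
    Real.div_rpow (x := u + c) (by positivity) (by norm_num), show -d - 1 = -(d + 1) by ring,
    Real.rpow_neg (by norm_num : (0:ℝ) ≤ 2), Real.rpow_add_one (by norm_num)]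
  field_simp

theorem map_mul_scalePrior {d c : ℝ} (hd : 0 < d) (hc : 0 < c) :
    (scalePrior d c).map (fun p ↦ p.1 * p.2) =
      ENNReal.ofReal (d * c ^ d) • lomaxMeasure d c := by
  ext s hs
  rw [← lintegral_indicator_one hs, lintegral_map (measurable_one.indicator hs) (by fun_prop),
    lintegral_scalePrior hd hc (measurable_one.indicator hs), lintegral_indicator_one hs]
  rfl

theorem integral_rpow_add_Ioi {d c : ℝ} (hd : 0 < d) (hc : 0 < c) :
    IntegrableOn (fun u ↦ (u + c) ^ (-d - 1)) (Set.Ioi 0) ∧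
      ∫ u in Set.Ioi 0, (u + c) ^ (-d - 1) = c ^ (-d) / d := by
  have h := integrableOn_Ioi_rpow_of_lt (show -d - 1 < -1 by linarith) hc
  have h' := integral_Ioi_rpow_of_lt (show -d - 1 < -1 by linarith) hc
  have hmp := measurePreserving_add_right volume c
  have hme := (MeasurableEquiv.addRight c).measurableEmbedding
  have hpre : (fun u ↦ u + c) ⁻¹' Set.Ioi c = Set.Ioi 0 := by ext; simp
  constructor
  · rw [← hpre]
    exact (hmp.integrableOn_comp_preimage hme).2 h
  · rw [← hpre, hmp.setIntegral_preimage_emb hme (fun y ↦ y ^ (-d - 1)), h', sub_add_cancel,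
      neg_div_neg_eq]

instance isFiniteMeasure_lomaxMeasure {d c : ℝ} [hd : Fact (0 < d)] [hc : Fact (0 < c)] :
    IsFiniteMeasure (lomaxMeasure d c) :=
  isFiniteMeasure_withDensity_ofReal (integral_rpow_add_Ioi hd.out hc.out).1.hasFiniteIntegral

theorem isFiniteMeasure_scalePrior {d c : ℝ} (hd : 0 < d) (hc : 0 < c) :
    IsFiniteMeasure (scalePrior d c) := by
  have := Fact.mk hd
  have := Fact.mk hc
  refine ⟨?_⟩
  have h := lintegral_scalePrior hd hc (f := fun _ ↦ 1) measurable_const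
  rw [lintegral_one, lintegral_one] at h
  rw [h]
  exact ENNReal.mul_lt_top ENNReal.ofReal_lt_top (measure_lt_top _ _)

end ScaleLaw

end SparseNormalMeans

namespace SparseNormalMeans

/-! ### Conditional marginal density and conditional posterior mean given the scale. -/

section GaussianConvolution

variable {E : Type*} [NormedAddCommGroup E] [InnerProductSpace ℝ E]

/-- Completing the square in `z`: prior times likelihood is a Gaussian of precision `1 + u` centred
at `(√u/(1+u)) y`, times a factor depending only on `y`. -/
theorem stdDensity_mul_exp {u : ℝ} (hu : 0 ≤ u) (y z : E) :
    stdDensity z * Real.exp (-‖y - Real.sqrt u • z‖ ^ 2 / 2) =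
      (2 * Real.pi) ^ (-(Module.finrank ℝ E / 2 : ℝ)) *
        Real.exp (-‖y‖ ^ 2 / (2 * (1 + u))) *
        Real.exp (-((1 + u) / 2) * ‖z - (Real.sqrt u / (1 + u)) • y‖ ^ 2) := by
  have h1 : 0 < 1 + u := by linarith
  rw [stdDensity, mul_assoc, mul_assoc, ← Real.exp_add, ← Real.exp_add]
  congr 2
  rw [@norm_sub_sq_real, @norm_sub_sq_real, norm_smul, norm_smul, mul_pow, mul_pow,
    Real.norm_of_nonneg (Real.sqrt_nonneg u), Real.norm_of_nonneg (by positivity), div_pow,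
    Real.sq_sqrt hu, real_inner_smul_right, real_inner_smul_right, real_inner_comm]
  field_simp
  ring

variable [FiniteDimensional ℝ E] [MeasurableSpace E] [BorelSpace E]

theorem integrable_exp_neg_mul_norm_sq_smul {b : ℝ} (hb : 0 < b) :
    Integrable (fun x : E ↦ Real.exp (-b * ‖x‖ ^ 2) • x) := by
  refine ((integrable_exp_neg_mul_norm_sq (E := E) (half_pos hb)).const_mul
    (Real.exp (1 / (2 * b)))).mono' (by fun_prop) (ae_of_all _ fun x ↦ ?_)
  rw [norm_smul, Real.norm_of_nonneg (Real.exp_pos _).le, ← Real.exp_add]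
  calc Real.exp (-b * ‖x‖ ^ 2) * ‖x‖ ≤ Real.exp (-b * ‖x‖ ^ 2) * Real.exp ‖x‖ := by
        gcongr; linarith [Real.add_one_le_exp ‖x‖]
    _ ≤ _ := by
        rw [← Real.exp_add]
        refine Real.exp_le_exp.2 ?_
        have : 1 / (2 * b) + -(b / 2) * ‖x‖ ^ 2 - (-b * ‖x‖ ^ 2 + ‖x‖) =
          (b * ‖x‖ - 1) ^ 2 / (2 * b) := by field_simp; ring
        have h2 : 0 ≤ (b * ‖x‖ - 1) ^ 2 / (2 * b) := by positivity
        linarith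

/-- The integrand is odd. -/
theorem integral_exp_neg_mul_norm_sq_smul (b : ℝ) :
    ∫ x : E, Real.exp (-b * ‖x‖ ^ 2) • x = 0 := by
  have h := integral_neg_eq_self (fun x : E ↦ Real.exp (-b * ‖x‖ ^ 2) • x) volume
  simp only [norm_neg, smul_neg, integral_neg] at h
  have h2 : (2 : ℝ) • ∫ x : E, Real.exp (-b * ‖x‖ ^ 2) • x = 0 := by
    rw [two_smul]
    nth_rewrite 1 [← h]
    exact neg_add_cancel _
  exact (smul_eq_zero.1 h2).resolve_left two_ne_zero

theorem integral_stdGaussian {F : Type*} [NormedAddCommGroup F] [NormedSpace ℝ F] (f : E → F) :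
    ∫ x, f x ∂stdGaussian E = ∫ x, stdDensity x • f x := by
  rw [stdGaussian_eq_withDensity, integral_withDensity_eq_integral_toReal_smul
    continuous_stdDensity.measurable.ennreal_ofReal (by simp)]
  simp_rw [ENNReal.toReal_ofReal (stdDensity_nonneg _)]

/-- Up to a constant, the density at `y` of a normal vector with covariance `(1 + u) • 1`, as a
function of the squared norm `s` of `y`. -/
noncomputable def marginalWeight (k : ℕ) (s u : ℝ) : ℝ :=
  (1 + u) ^ (-(k / 2 : ℝ)) * Real.exp (-s / (2 * (1 + u)))

theorem const_mul_integral_exp {u : ℝ} (hu : 0 ≤ u) (y : E) :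
    (2 * Real.pi) ^ (-(Module.finrank ℝ E / 2 : ℝ)) *
        Real.exp (-‖y‖ ^ 2 / (2 * (1 + u))) * ∫ z : E, Real.exp (-((1 + u) / 2) * ‖z‖ ^ 2) =
      marginalWeight (Module.finrank ℝ E) (‖y‖ ^ 2) u := by
  have h1 : 0 < 1 + u := by linarith
  rw [GaussianFourier.integral_rexp_neg_mul_sq_norm (by positivity), marginalWeight,
    show Real.pi / ((1 + u) / 2) = (2 * Real.pi) * (1 + u)⁻¹ by field_simp,
    Real.mul_rpow (x := 2 * Real.pi) (by positivity) (by positivity), mul_right_comm,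
    ← mul_assoc, ← Real.rpow_add (by positivity), neg_add_cancel, Real.rpow_zero, one_mul,
    Real.inv_rpow h1.le, Real.rpow_neg h1.le]

theorem integral_exp_stdGaussian {u : ℝ} (hu : 0 ≤ u) (y : E) :
    ∫ z, Real.exp (-‖y - Real.sqrt u • z‖ ^ 2 / 2) ∂stdGaussian E =
      marginalWeight (Module.finrank ℝ E) (‖y‖ ^ 2) u := by
  rw [integral_stdGaussian]
  simp_rw [smul_eq_mul, stdDensity_mul_exp hu]
  rw [integral_const_mul, integral_sub_right_eq_self
    (fun z : E ↦ Real.exp (-((1 + u) / 2) * ‖z‖ ^ 2)), const_mul_integral_exp hu]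

/-- After recentring at `m = (√u/(1+u)) y` the odd part integrates to zero, and `√u • m` is the
conjugate normal shrinkage `(u/(1+u)) y`. -/
theorem integral_exp_smul_stdGaussian {u : ℝ} (hu : 0 ≤ u) (y : E) :
    ∫ z, Real.exp (-‖y - Real.sqrt u • z‖ ^ 2 / 2) • Real.sqrt u • z ∂stdGaussian E =
      (marginalWeight (Module.finrank ℝ E) (‖y‖ ^ 2) u * (u / (1 + u))) • y := by
  have h1 : 0 < (1 + u) / 2 := by linarith
  set m : E := (Real.sqrt u / (1 + u)) • y with hm
  rw [integral_stdGaussian]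
  have e : ∀ z : E, stdDensity z • Real.exp (-‖y - Real.sqrt u • z‖ ^ 2 / 2) • Real.sqrt u • z =
      ((2 * Real.pi) ^ (-(Module.finrank ℝ E / 2 : ℝ)) * Real.exp (-‖y‖ ^ 2 / (2 * (1 + u))) *
        Real.sqrt u) • (fun z : E ↦ Real.exp (-((1 + u) / 2) * ‖z‖ ^ 2) • (z + m)) (z - m) :=
    fun z ↦ by
      beta_reduce
      rw [sub_add_cancel, ← mul_smul, ← mul_smul, ← mul_smul,
        stdDensity_mul_exp hu, ← hm]
      congr 1
      ring
  rw [integral_congr_ae (ae_of_all _ e), integral_smul, integral_sub_right_eq_self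
    (fun z : E ↦ Real.exp (-((1 + u) / 2) * ‖z‖ ^ 2) • (z + m))]
  simp_rw [smul_add]
  rw [integral_add (integrable_exp_neg_mul_norm_sq_smul h1)
    ((integrable_exp_neg_mul_norm_sq h1).smul_const m), integral_exp_neg_mul_norm_sq_smul,
    zero_add, integral_smul_const, hm, ← const_mul_integral_exp hu, smul_smul, smul_smul]
  congr 1
  have := Real.mul_self_sqrt hu
  field_simp
  rw [Real.sq_sqrt hu]

end GaussianConvolution

/-! ### The posterior mean as a radial shrinkage. -/

section PosteriorMean

variable {k : ℕ} {S : Matrix (Fin k) (Fin k) ℝ}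

/-- A draw from the prior is `A (√u z)` with `z` standard normal and independent of the scales. This
product form makes Fubini available. -/
theorem eigPrior_eq_map (hS : S.PosDef) {d c : ℝ} (hd : 0 < d) (hc : 0 < c)
    {A : EuclideanSpace ℝ (Fin k) ≃L[ℝ] EuclideanSpace ℝ (Fin k)}
    (hA : ∀ v, multivariateGaussian (A v) S =
        (stdGaussian (EuclideanSpace ℝ (Fin k))).map (fun x ↦ A (v + x))) :
    eigPrior S d c = ((scalePrior d c).prod (stdGaussian (EuclideanSpace ℝ (Fin k)))).map
      (fun w ↦ A (Real.sqrt (w.1.1 * w.1.2) • w.2)) := by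
  have := isFiniteMeasure_scalePrior hd hc
  have hm : Measurable fun w : (ℝ × ℝ) × EuclideanSpace ℝ (Fin k) ↦
      A (Real.sqrt (w.1.1 * w.1.2) • w.2) := by fun_prop
  ext s hs
  rw [eigPrior, Measure.bind_apply hs (measurable_conditionalPrior hS).aemeasurable,
    Measure.map_apply hm hs, Measure.prod_apply (hm hs)]
  -- The scaling rule for the normal law needs a nonnegative factor, while the scale prior is a
  -- measure on all of `ℝ × ℝ`.
  have hpos : ∀ᵐ p ∂scalePrior d c, 0 ≤ p.1 * p.2 := by
    have h := lintegral_scalePrior hd hc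
      (measurable_one.indicator (measurableSet_Iio (a := (0 : ℝ))))
    rw [lintegral_lomaxMeasure (measurable_one.indicator measurableSet_Iio)] at h
    have h0 : ∫⁻ u in Set.Ioi 0, ENNReal.ofReal ((u + c) ^ (-d - 1)) *
        (Set.Iio (0 : ℝ)).indicator 1 u = 0 := by
      rw [setLIntegral_congr_fun (g := 0) measurableSet_Ioi fun u (hu : 0 < u) ↦ by
        simp [hu.le]]
      simp
    rw [h0, mul_zero, lintegral_eq_zero_iff (by
      exact (measurable_one.indicator measurableSet_Iio).comp (by fun_prop))] at h
    filter_upwards [h] with p hp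
    by_contra hneg
    simp [not_le.1 hneg] at hp
  refine lintegral_congr_ae ?_
  filter_upwards [hpos] with p hp
  have h0 := hA 0
  simp only [map_zero, zero_add] at h0
  rw [multivariateGaussian_smul hS hp, h0, Measure.map_map (by fun_prop) (by fun_prop),
    Measure.map_apply (by fun_prop) hs]
  congr 1
  ext z
  simp

theorem marginalWeight_nonneg (s : ℝ) {u : ℝ} (hu : 0 ≤ u) : 0 ≤ marginalWeight k s u := by
  unfold marginalWeight; positivity

theorem marginalWeight_le_one {s u : ℝ} (hs : 0 ≤ s) (hu : 0 ≤ u) : marginalWeight k s u ≤ 1 := by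
  unfold marginalWeight
  refine mul_le_one₀ (Real.rpow_le_one_of_one_le_of_nonpos (by linarith)
    (by simp; positivity)) (Real.exp_pos _).le (Real.exp_le_one_iff.2 ?_)
  rw [neg_div]
  have : 0 ≤ s / (2 * (1 + u)) := by positivity
  linarith

@[fun_prop]
theorem measurable_marginalWeight : Measurable fun p : ℝ × ℝ ↦ marginalWeight k p.1 p.2 := by
  unfold marginalWeight; fun_prop

theorem ae_lomaxMeasure_pos (d c : ℝ) : ∀ᵐ u ∂lomaxMeasure d c, 0 < u :=
  (withDensity_absolutelyContinuous _ _).ae_le (ae_restrict_mem measurableSet_Ioi)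

/-- The posterior expectation of `u / (1 + u)`, where `u = λ² τ`, given a vector of squared
Mahalanobis norm `s`. -/
noncomputable def shrinkFactor (k : ℕ) (d c s : ℝ) : ℝ :=
  (∫ u, marginalWeight k s u ∂lomaxMeasure d c)⁻¹ *
    ∫ u, marginalWeight k s u * (u / (1 + u)) ∂lomaxMeasure d c

theorem measurable_shrinkFactor (k : ℕ) {d c : ℝ} (hd : 0 < d) (hc : 0 < c) :
    Measurable (shrinkFactor k d c) := by
  have := Fact.mk hd
  have := Fact.mk hc
  have h1 : Measurable fun p : ℝ × ℝ ↦ marginalWeight k p.1 p.2 := measurable_marginalWeight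
  unfold shrinkFactor
  refine Measurable.mul (Measurable.inv ?_) ?_
  · exact (h1.stronglyMeasurable.integral_prod_right).measurable
  · exact ((h1.mul (by fun_prop : Measurable fun p : ℝ × ℝ ↦ p.2 / (1 + p.2)
      )).stronglyMeasurable.integral_prod_right).measurable

theorem normalDensity_map_map
    {A : EuclideanSpace ℝ (Fin k) ≃L[ℝ] EuclideanSpace ℝ (Fin k)}
    (hA : ∀ x, mahalSq S (A x) = ‖x‖ ^ 2) (t y : EuclideanSpace ℝ (Fin k)) :
    normalDensity S (A t) (A y) =
      (Real.sqrt ((2 * Real.pi) ^ k * S.det))⁻¹ * Real.exp (-‖y - t‖ ^ 2 / 2) := by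
  rw [normalDensity, ← map_sub, hA]

/-- Fubini separates the scale from the standard normal vector, the Gaussian convolution formulas
evaluate the inner integrals, and the constants `C` and `d c^d` cancel in Bayes' quotient. -/
theorem eigPosteriorMean_map (hS : S.PosDef) {d c : ℝ} (hd : 0 < d) (hc : 0 < c)
    {A : EuclideanSpace ℝ (Fin k) ≃L[ℝ] EuclideanSpace ℝ (Fin k)}
    (hA : ∀ x, mahalSq S (A x) = ‖x‖ ^ 2)
    (hA' : ∀ v, multivariateGaussian (A v) S =
        (stdGaussian (EuclideanSpace ℝ (Fin k))).map (fun x ↦ A (v + x)))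
    (y : EuclideanSpace ℝ (Fin k)) :
    eigPosteriorMean S d c (A y) = shrinkFactor k d c (‖y‖ ^ 2) • A y := by
  have := isFiniteMeasure_scalePrior hd hc
  have hfd := Fact.mk hd
  have hfc := Fact.mk hc
  set C := (Real.sqrt ((2 * Real.pi) ^ k * S.det))⁻¹ with hC
  have hC0 : 0 < C := by
    have := hS.det_pos
    positivity
  have hm : Measurable fun w : (ℝ × ℝ) × EuclideanSpace ℝ (Fin k) ↦
      A (Real.sqrt (w.1.1 * w.1.2) • w.2) := by fun_prop
  have hnd : Continuous fun t ↦ normalDensity S t (A y) := by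
    have : (fun t ↦ normalDensity S t (A y)) =
        fun t ↦ C * Real.exp (-‖y - A.symm t‖ ^ 2 / 2) := by
      funext t
      rw [← normalDensity_map_map hA, A.apply_symm_apply]
    rw [this]; fun_prop
  -- With `r = ‖y - t‖` this bounds the vector-valued integrand `density • t` uniformly in `t`, so
  -- it is integrable and Fubini applies.
  have hexp : ∀ r : ℝ, r * Real.exp (-r ^ 2 / 2) ≤ 1 := fun r ↦ by
    rw [neg_div, Real.exp_neg, ← div_eq_mul_inv, div_le_one (Real.exp_pos _)]
    nlinarith [Real.add_one_le_exp (r ^ 2 / 2), sq_nonneg (r - 1)]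
  have hmap : ∀ H : ℝ → EuclideanSpace ℝ (Fin k), StronglyMeasurable H →
      ∫ p, H (p.1 * p.2) ∂scalePrior d c = (d * c ^ d) • ∫ u, H u ∂lomaxMeasure d c := by
    intro H hH
    rw [← integral_map (f := H) (φ := fun p : ℝ × ℝ ↦ p.1 * p.2) (by fun_prop)
      hH.aestronglyMeasurable,
      map_mul_scalePrior hd hc, integral_smul_measure, ENNReal.toReal_ofReal (by positivity)]
  have hmap' : ∀ H : ℝ → ℝ, StronglyMeasurable H →
      ∫ p, H (p.1 * p.2) ∂scalePrior d c = (d * c ^ d) * ∫ u, H u ∂lomaxMeasure d c := by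
    intro H hH
    rw [← integral_map (f := H) (φ := fun p : ℝ × ℝ ↦ p.1 * p.2) (by fun_prop)
      hH.aestronglyMeasurable,
      map_mul_scalePrior hd hc, integral_smul_measure, ENNReal.toReal_ofReal (by positivity),
      smul_eq_mul]
  have h1 : ∫ t, normalDensity S t (A y) ∂eigPrior S d c =
      C * (d * c ^ d) * ∫ u, marginalWeight k (‖y‖ ^ 2) u ∂lomaxMeasure d c := by
    rw [eigPrior_eq_map hS hd hc hA', integral_map hm.aemeasurable hnd.aestronglyMeasurable,
      integral_prod]
    · simp_rw [normalDensity_map_map hA, ← hC, integral_const_mul]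
      rw [hmap' (fun u ↦ ∫ z, Real.exp (-‖y - Real.sqrt u • z‖ ^ 2 / 2)
        ∂stdGaussian (EuclideanSpace ℝ (Fin k))), ← mul_assoc]
      · congr 1
        refine integral_congr_ae ?_
        filter_upwards [ae_lomaxMeasure_pos d c] with u hu
        rw [integral_exp_stdGaussian hu.le]
        simp
      · exact StronglyMeasurable.integral_prod_right
          (by fun_prop : Continuous fun w : ℝ × EuclideanSpace ℝ (Fin k) ↦
            Real.exp (-‖y - Real.sqrt w.1 • w.2‖ ^ 2 / 2)).stronglyMeasurable
    · refine Integrable.of_bound (hnd.measurable.comp hm).aestronglyMeasurable C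
        (ae_of_all _ fun w ↦ ?_)
      rw [normalDensity_map_map hA, ← hC, Real.norm_of_nonneg (by positivity)]
      refine mul_le_of_le_one_right hC0.le (Real.exp_le_one_iff.2 ?_)
      have : 0 ≤ ‖y - Real.sqrt (w.1.1 * w.1.2) • w.2‖ ^ 2 := by positivity
      linarith
  have h2 : ∫ t, normalDensity S t (A y) • t ∂eigPrior S d c =
      (C * (d * c ^ d) * ∫ u, marginalWeight k (‖y‖ ^ 2) u * (u / (1 + u)) ∂lomaxMeasure d c) •
        A y := by
    have hcont : Continuous fun t ↦ normalDensity S t (A y) • t := hnd.smul continuous_id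
    rw [eigPrior_eq_map hS hd hc hA', integral_map hm.aemeasurable
      hcont.aestronglyMeasurable, integral_prod]
    · simp_rw [normalDensity_map_map hA, ← hC, mul_smul, integral_smul]
      have hin : ∀ u : ℝ, ∫ z, Real.exp (-‖y - Real.sqrt u • z‖ ^ 2 / 2) • A (Real.sqrt u • z)
          ∂stdGaussian (EuclideanSpace ℝ (Fin k)) =
          A (∫ z, Real.exp (-‖y - Real.sqrt u • z‖ ^ 2 / 2) • Real.sqrt u • z
          ∂stdGaussian (EuclideanSpace ℝ (Fin k))) := fun u ↦ by
        rw [← A.integral_comp_comm]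
        simp_rw [map_smul]
      simp_rw [hin]
      rw [hmap (fun u ↦ A (∫ z, Real.exp (-‖y - Real.sqrt u • z‖ ^ 2 / 2) • Real.sqrt u • z
          ∂stdGaussian (EuclideanSpace ℝ (Fin k))))]
      · rw [A.integral_comp_comm]
        have : ∫ u, (∫ z, Real.exp (-‖y - Real.sqrt u • z‖ ^ 2 / 2) • Real.sqrt u • z
            ∂stdGaussian (EuclideanSpace ℝ (Fin k))) ∂lomaxMeasure d c =
            (∫ u, marginalWeight k (‖y‖ ^ 2) u * (u / (1 + u)) ∂lomaxMeasure d c) • y := by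
          rw [← integral_smul_const]
          refine integral_congr_ae ?_
          filter_upwards [ae_lomaxMeasure_pos d c] with u hu
          rw [integral_exp_smul_stdGaussian hu.le]
          simp
        rw [this, map_smul]
        simp only [smul_smul, mul_assoc]
      · exact A.continuous.comp_stronglyMeasurable (StronglyMeasurable.integral_prod_right
          (by fun_prop : Continuous fun w : ℝ × EuclideanSpace ℝ (Fin k) ↦
            Real.exp (-‖y - Real.sqrt w.1 • w.2‖ ^ 2 / 2) • Real.sqrt w.1 • w.2).stronglyMeasurable)
    · refine Integrable.of_bound (hcont.measurable.comp hm).aestronglyMeasurable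
        (C * (‖(A : EuclideanSpace ℝ (Fin k) →L[ℝ] EuclideanSpace ℝ (Fin k))‖ * (‖y‖ + 1)))
        (ae_of_all _ fun w ↦ ?_)
      set t := Real.sqrt (w.1.1 * w.1.2) • w.2 with ht
      rw [normalDensity_map_map hA, ← hC, norm_smul, Real.norm_of_nonneg (by positivity), mul_assoc]
      have e1 : ‖A t‖ ≤ ‖(A : EuclideanSpace ℝ (Fin k) →L[ℝ] EuclideanSpace ℝ (Fin k))‖ * ‖t‖ :=
        (A : EuclideanSpace ℝ (Fin k) →L[ℝ] EuclideanSpace ℝ (Fin k)).le_opNorm t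
      have e2 : ‖t‖ ≤ ‖y‖ + ‖y - t‖ := by
        simpa using norm_sub_le y (y - t)
      have e3 : Real.exp (-‖y - t‖ ^ 2 / 2) ≤ 1 := by
        refine Real.exp_le_one_iff.2 ?_
        have : 0 ≤ ‖y - t‖ ^ 2 := by positivity
        linarith
      refine mul_le_mul_of_nonneg_left ?_ hC0.le
      calc Real.exp (-‖y - t‖ ^ 2 / 2) * ‖A t‖
          ≤ Real.exp (-‖y - t‖ ^ 2 / 2) *
            (‖(A : EuclideanSpace ℝ (Fin k) →L[ℝ] EuclideanSpace ℝ (Fin k))‖ *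
              (‖y‖ + ‖y - t‖)) := by
            gcongr
            exact e1.trans (by gcongr)
        _ = ‖(A : EuclideanSpace ℝ (Fin k) →L[ℝ] EuclideanSpace ℝ (Fin k))‖ *
            (Real.exp (-‖y - t‖ ^ 2 / 2) * ‖y‖ + ‖y - t‖ * Real.exp (-‖y - t‖ ^ 2 / 2)) := by
            ring
        _ ≤ _ := by
            gcongr
            · exact mul_le_of_le_one_left (norm_nonneg _) e3
            · exact hexp _
  rw [eigPosteriorMean, h1, h2, smul_smul, shrinkFactor, mul_inv]
  congr 1
  have : C * (d * c ^ d) ≠ 0 := by positivity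
  field_simp

end PosteriorMean

end SparseNormalMeans

namespace SparseNormalMeans

/-! ### Estimates of the shrinkage factor near and far from the origin. -/

section ShrinkFactor

/-- The maximum is attained at `x = p/r`; the extra factor `e^(-p)` is dropped. -/
theorem rpow_mul_exp_neg_le {p r x : ℝ} (hp : 0 < p) (hr : 0 < r) (hx : 0 < x) :
    x ^ p * Real.exp (-(r * x)) ≤ (p / r) ^ p := by
  have h := Real.log_le_sub_one_of_pos (show 0 < r * x / p by positivity)
  rw [Real.log_div (by positivity) hp.ne', Real.log_mul hr.ne' hx.ne'] at h
  rw [Real.rpow_def_of_pos hx, Real.rpow_def_of_pos (by positivity), ← Real.exp_add,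
    Real.log_div hp.ne' hr.ne']
  refine Real.exp_le_exp.2 ?_
  have h2 : p * (r * x / p) = r * x := by field_simp
  nlinarith

theorem integral_lomaxMeasure (d : ℝ) {c : ℝ} (hc : 0 < c) (f : ℝ → ℝ) :
    ∫ u, f u ∂lomaxMeasure d c = ∫ u in Set.Ioi 0, (u + c) ^ (-d - 1) * f u := by
  rw [lomaxMeasure, integral_withDensity_eq_integral_toReal_smul (by fun_prop) (by simp)]
  refine setIntegral_congr_fun measurableSet_Ioi fun u (hu : 0 < u) ↦ ?_
  simp only [smul_eq_mul]
  rw [ENNReal.toReal_ofReal (by positivity)]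

variable {k : ℕ} {d c s : ℝ}

theorem integrable_lomaxMeasure (hd : 0 < d) (hc : 0 < c) {f : ℝ → ℝ} (hf : Measurable f)
    (h : ∀ u, 0 < u → ‖f u‖ ≤ 1) : Integrable f (lomaxMeasure d c) := by
  have := Fact.mk hd
  have := Fact.mk hc
  refine Integrable.of_bound hf.aestronglyMeasurable 1 ?_
  filter_upwards [ae_lomaxMeasure_pos d c] with u hu using h u hu

theorem integrable_marginalWeight_mul (hd : 0 < d) (hc : 0 < c) (hs : 0 ≤ s) {g : ℝ → ℝ}
    (hg : Measurable g) (hg0 : ∀ u, 0 < u → 0 ≤ g u) (hg1 : ∀ u, 0 < u → g u ≤ 1) :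
    Integrable (fun u ↦ marginalWeight k s u * g u) (lomaxMeasure d c) :=
  integrable_lomaxMeasure hd hc
    ((measurable_marginalWeight.comp (measurable_prodMk_left (x := s))).mul hg)
    fun u hu ↦ by
      rw [Real.norm_of_nonneg (mul_nonneg (marginalWeight_nonneg s hu.le) (hg0 u hu))]
      exact mul_le_one₀ (marginalWeight_le_one hs hu.le) (hg0 u hu) (hg1 u hu)

theorem integral_marginalWeight_mul_nonneg (s : ℝ) {g : ℝ → ℝ} (hg : ∀ u, 0 < u → 0 ≤ g u) :
    0 ≤ ∫ u, marginalWeight k s u * g u ∂lomaxMeasure d c := by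
  refine integral_nonneg_of_ae ?_
  filter_upwards [ae_lomaxMeasure_pos d c] with u hu
  exact mul_nonneg (marginalWeight_nonneg s hu.le) (hg u hu)

theorem mul_const_le_integral_marginalWeight (hd : 0 < d) (hc : 0 < c) (hs : 0 ≤ s)
    {a b m : ℝ} (ha : 0 ≤ a) (hab : a ≤ b)
    (h : ∀ u, a < u → u < b → m ≤ (u + c) ^ (-d - 1) * marginalWeight k s u) :
    (b - a) * m ≤ ∫ u, marginalWeight k s u ∂lomaxMeasure d c := by
  rw [integral_lomaxMeasure d hc]
  have hint : IntegrableOn (fun u ↦ (u + c) ^ (-d - 1) * marginalWeight k s u) (Set.Ioi 0) := by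
    refine (integral_rpow_add_Ioi hd hc).1.mono' ?_ ?_
    · exact ((by fun_prop : Measurable fun u : ℝ ↦ (u + c) ^ (-d - 1)).mul
        (measurable_marginalWeight.comp measurable_prodMk_left)).aestronglyMeasurable
    · filter_upwards [ae_restrict_mem measurableSet_Ioi] with u hu
      have hu : 0 < u := hu
      have := marginalWeight_nonneg (k := k) s hu.le
      rw [Real.norm_of_nonneg (by positivity)]
      exact mul_le_of_le_one_right (by positivity) (marginalWeight_le_one hs hu.le)
  have hsub : Set.Ioo a b ⊆ Set.Ioi 0 := fun u hu ↦ ha.trans_lt hu.1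
  calc (b - a) * m = ∫ _ in Set.Ioo a b, m := by
        simp [measureReal_def, ENNReal.toReal_ofReal (sub_nonneg.2 hab)]
    _ ≤ ∫ u in Set.Ioo a b, (u + c) ^ (-d - 1) * marginalWeight k s u :=
        setIntegral_mono_on (by simp) (hint.mono_set hsub) measurableSet_Ioo
          fun u hu ↦ h u hu.1 hu.2
    _ ≤ _ := by
        refine setIntegral_mono_set hint ?_ hsub.eventuallyLE
        filter_upwards [ae_restrict_mem measurableSet_Ioi] with u hu
        have hu : 0 < u := hu
        have := marginalWeight_nonneg (k := k) s hu.le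
        simp only [Pi.zero_apply]
        positivity

/-- Only scales `u < c` are kept: there `u + c ≤ 2c` and `1 + u ≤ 2`, and the interval has length
`c`. -/
theorem le_integral_marginalWeight_small (hd : 0 < d) (hc : 0 < c) (hc1 : c ≤ 1) (hs : 0 ≤ s) :
    2 ^ (-(k / 2 : ℝ)) * 2 ^ (-d - 1) * (c ^ (-d) * Real.exp (-s / 2)) ≤
      ∫ u, marginalWeight k s u ∂lomaxMeasure d c := by
  have h := mul_const_le_integral_marginalWeight (k := k) hd hc hs le_rfl hc.le
    (m := (2 * c) ^ (-d - 1) * (2 ^ (-(k / 2 : ℝ)) * Real.exp (-s / 2))) fun u hu huc ↦ by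
      have : u + c ≤ 2 * c := by linarith
      have h1 : (2 * c) ^ (-d - 1) ≤ (u + c) ^ (-d - 1) :=
        Real.rpow_le_rpow_of_nonpos (by linarith) this (by linarith)
      have h2 : (2 : ℝ) ^ (-(k / 2 : ℝ)) ≤ (1 + u) ^ (-(k / 2 : ℝ)) :=
        Real.rpow_le_rpow_of_nonpos (by linarith) (by linarith) (by simp; positivity)
      have h3 : Real.exp (-s / 2) ≤ Real.exp (-s / (2 * (1 + u))) := by
        refine Real.exp_le_exp.2 ?_
        rw [neg_div, neg_div, neg_le_neg_iff]
        exact div_le_div_of_nonneg_left hs (by norm_num) (by linarith)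
      rw [marginalWeight]
      gcongr
  refine le_trans (le_of_eq ?_) h
  rw [sub_zero, Real.mul_rpow (by norm_num) hc.le, show -d = (-d - 1) + 1 by ring,
    Real.rpow_add_one hc.ne']
  ring_nf

/-- Only scales `s < u < 2s` are kept: there the exponential is at least `e^(-1/2)`, and `u + c` and
`1 + u` are at most `3s`. The heavy tail of the prior thus makes the marginal decay only
polynomially in `s`. -/
theorem le_integral_marginalWeight_large (hd : 0 < d) (hc : 0 < c) (hc1 : c ≤ 1) (hs : 1 ≤ s) :
    3 ^ (-(k / 2 + d + 1 : ℝ)) * Real.exp (-1 / 2) * s ^ (-(k / 2 + d : ℝ)) ≤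
      ∫ u, marginalWeight k s u ∂lomaxMeasure d c := by
  have hs0 : 0 < s := by linarith
  have h := mul_const_le_integral_marginalWeight (k := k) hd hc hs0.le hs0.le
    (show s ≤ 2 * s by linarith)
    (m := (3 * s) ^ (-d - 1) * ((3 * s) ^ (-(k / 2 : ℝ)) * Real.exp (-1 / 2))) fun u hu hus ↦ by
      have h1 : (3 * s) ^ (-d - 1) ≤ (u + c) ^ (-d - 1) :=
        Real.rpow_le_rpow_of_nonpos (by linarith) (by linarith) (by linarith)
      have h2 : (3 * s) ^ (-(k / 2 : ℝ)) ≤ (1 + u) ^ (-(k / 2 : ℝ)) :=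
        Real.rpow_le_rpow_of_nonpos (by linarith) (by linarith) (by simp; positivity)
      have h3 : Real.exp (-1 / 2) ≤ Real.exp (-s / (2 * (1 + u))) := by
        refine Real.exp_le_exp.2 ?_
        rw [div_le_div_iff₀ (by norm_num) (by linarith)]
        linarith
      have : 0 < u + c := by linarith
      have : 0 < 1 + u := by linarith
      rw [marginalWeight]
      gcongr
  refine le_trans (le_of_eq ?_) h
  rw [← mul_assoc ((3 * s) ^ (-d - 1)), ← Real.rpow_add (by positivity),
    Real.mul_rpow (by norm_num) hs0.le, show 2 * s - s = s by ring, show -d - 1 + -(k / 2 : ℝ) = -(k / 2 + d + 1) by ring,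
    show -(k / 2 + d : ℝ) = -(k / 2 + d + 1) + 1 by ring, Real.rpow_add_one hs0.ne']
  ring

theorem integral_marginalWeight_pos (hd : 0 < d) (hc : 0 < c) (hs : 0 ≤ s) :
    0 < ∫ u, marginalWeight k s u ∂lomaxMeasure d c := by
  have h := mul_const_le_integral_marginalWeight (k := k) hd hc hs le_rfl zero_le_one
    (m := (1 + c) ^ (-d - 1) * (2 ^ (-(k / 2 : ℝ)) * Real.exp (-s / 2))) fun u hu hu1 ↦ by
      have h1 : (1 + c) ^ (-d - 1) ≤ (u + c) ^ (-d - 1) :=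
        Real.rpow_le_rpow_of_nonpos (by linarith) (by linarith) (by linarith)
      have h2 : (2 : ℝ) ^ (-(k / 2 : ℝ)) ≤ (1 + u) ^ (-(k / 2 : ℝ)) :=
        Real.rpow_le_rpow_of_nonpos (by linarith) (by linarith) (by simp; positivity)
      have h3 : Real.exp (-s / 2) ≤ Real.exp (-s / (2 * (1 + u))) := by
        refine Real.exp_le_exp.2 ?_
        rw [neg_div, neg_div, neg_le_neg_iff]
        exact div_le_div_of_nonneg_left hs (by norm_num) (by linarith)
      rw [marginalWeight]
      gcongr
  exact lt_of_lt_of_le (by positivity) h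

theorem shrinkFactor_nonneg (hd : 0 < d) (hc : 0 < c) (hs : 0 ≤ s) : 0 ≤ shrinkFactor k d c s := by
  refine mul_nonneg (inv_nonneg.2 (integral_marginalWeight_pos hd hc hs).le)
    (integral_marginalWeight_mul_nonneg s fun u hu ↦ by positivity)

theorem one_sub_shrinkFactor (hd : 0 < d) (hc : 0 < c) (hs : 0 ≤ s) :
    1 - shrinkFactor k d c s = (∫ u, marginalWeight k s u ∂lomaxMeasure d c)⁻¹ *
      ∫ u, marginalWeight k s u * (1 / (1 + u)) ∂lomaxMeasure d c := by
  have hD := integral_marginalWeight_pos (k := k) hd hc hs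
  have h : ∫ u, marginalWeight k s u ∂lomaxMeasure d c =
      ∫ u, marginalWeight k s u * (u / (1 + u)) ∂lomaxMeasure d c +
      ∫ u, marginalWeight k s u * (1 / (1 + u)) ∂lomaxMeasure d c := by
    rw [← integral_add]
    · refine integral_congr_ae ?_
      filter_upwards [ae_lomaxMeasure_pos d c] with u hu
      field_simp
      ring
    · exact integrable_marginalWeight_mul hd hc hs (by fun_prop) (fun u hu ↦ by positivity)
        fun u hu ↦ by rw [div_le_one (by linarith)]; linarith
    · exact integrable_marginalWeight_mul hd hc hs (by fun_prop) (fun u hu ↦ by positivity)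
        fun u hu ↦ by rw [div_le_one (by linarith)]; linarith
  rw [shrinkFactor]
  nth_rewrite 1 [← inv_mul_cancel₀ hD.ne']
  rw [← mul_sub]
  congr 1
  linarith

theorem shrinkFactor_le_one (hd : 0 < d) (hc : 0 < c) (hs : 0 ≤ s) :
    shrinkFactor k d c s ≤ 1 := by
  rw [← sub_nonneg, one_sub_shrinkFactor hd hc hs]
  refine mul_nonneg (inv_nonneg.2 (integral_marginalWeight_pos hd hc hs).le)
    (integral_marginalWeight_mul_nonneg s fun u hu ↦ by positivity)

/-- The bound is uniform in `c` and `s`: the factor `u/(1+u)` tames the singularity at zero to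
`u^(-d)`, integrable since `d < 1`, and `u^(-d-1)` controls the tail. -/
theorem integral_marginalWeight_mul_le (hd : 0 < d) (hd1 : d < 1) (hc : 0 < c) (hs : 0 ≤ s) :
    ∫ u, marginalWeight k s u * (u / (1 + u)) ∂lomaxMeasure d c ≤ 1 / (1 - d) + 1 / d := by
  rw [integral_lomaxMeasure d hc]
  have i1 : IntegrableOn (fun u : ℝ ↦ u ^ (-d)) (Set.Ioc 0 1) :=
    (intervalIntegrable_iff_integrableOn_Ioc_of_le zero_le_one).1
      (intervalIntegral.intervalIntegrable_rpow' (by linarith))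
  have i2 : IntegrableOn (fun u : ℝ ↦ u ^ (-d - 1)) (Set.Ioi 1) :=
    integrableOn_Ioi_rpow_of_lt (by linarith) one_pos
  have v1 : ∫ u in Set.Ioc (0 : ℝ) 1, u ^ (-d) = 1 / (1 - d) := by
    rw [← intervalIntegral.integral_of_le zero_le_one, integral_rpow (Or.inl (by linarith))]
    rw [Real.zero_rpow (show -d + 1 ≠ 0 by linarith), Real.one_rpow, sub_zero, neg_add_eq_sub]
  have v2 : ∫ u in Set.Ioi (1 : ℝ), u ^ (-d - 1) = 1 / d := by
    rw [integral_Ioi_rpow_of_lt (by linarith) one_pos]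
    simp
  have hb : ∀ u, 0 < u → (u + c) ^ (-d - 1) * (marginalWeight k s u * (u / (1 + u))) ≤
      u ^ (-d - 1) * (u / (1 + u)) := fun u hu ↦ by
    have h1 : (u + c) ^ (-d - 1) ≤ u ^ (-d - 1) :=
      Real.rpow_le_rpow_of_nonpos hu (by linarith) (by linarith)
    have := marginalWeight_nonneg (k := k) s hu.le
    gcongr
    exact mul_le_of_le_one_left (by positivity) (marginalWeight_le_one hs hu.le)
  have hn : ∀ u, 0 < u → 0 ≤ (u + c) ^ (-d - 1) * (marginalWeight k s u * (u / (1 + u))) :=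
    fun u hu ↦ by
      have := marginalWeight_nonneg (k := k) s hu.le
      positivity
  have hm : Measurable fun u ↦ (u + c) ^ (-d - 1) * (marginalWeight k s u * (u / (1 + u))) :=
    (by fun_prop : Measurable fun u : ℝ ↦ (u + c) ^ (-d - 1)).mul
      ((measurable_marginalWeight.comp measurable_prodMk_left).mul (by fun_prop))
  have hb1 : ∀ u ∈ Set.Ioc (0 : ℝ) 1,
      (u + c) ^ (-d - 1) * (marginalWeight k s u * (u / (1 + u))) ≤ u ^ (-d) := fun u hu ↦ by
    have hu0 := hu.1
    refine (hb u hu0).trans ?_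
    rw [show u ^ (-d) = u ^ (-d - 1) * u by rw [← Real.rpow_add_one hu0.ne']; ring_nf]
    gcongr
    exact div_le_self hu0.le (by linarith)
  have hb2 : ∀ u ∈ Set.Ioi (1 : ℝ),
      (u + c) ^ (-d - 1) * (marginalWeight k s u * (u / (1 + u))) ≤ u ^ (-d - 1) := fun u hu ↦ by
    have hu0 : 0 < u := one_pos.trans hu
    refine (hb u hu0).trans (mul_le_of_le_one_right (by positivity) ?_)
    rw [div_le_one (by linarith)]
    linarith
  have j1 : IntegrableOn (fun u ↦ (u + c) ^ (-d - 1) * (marginalWeight k s u * (u / (1 + u))))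
      (Set.Ioc 0 1) := by
    refine i1.mono' hm.aestronglyMeasurable ?_
    filter_upwards [ae_restrict_mem measurableSet_Ioc] with u hu
    rw [Real.norm_of_nonneg (hn u hu.1)]
    exact hb1 u hu
  have j2 : IntegrableOn (fun u ↦ (u + c) ^ (-d - 1) * (marginalWeight k s u * (u / (1 + u))))
      (Set.Ioi 1) := by
    refine i2.mono' hm.aestronglyMeasurable ?_
    filter_upwards [ae_restrict_mem measurableSet_Ioi] with u hu
    rw [Real.norm_of_nonneg (hn u (one_pos.trans hu))]
    exact hb2 u hu
  rw [← Set.Ioc_union_Ioi_eq_Ioi zero_le_one, setIntegral_union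
    (Set.Ioc_disjoint_Ioi le_rfl) measurableSet_Ioi j1 j2, ← v1, ← v2]
  exact add_le_add (setIntegral_mono_on j1 i1 measurableSet_Ioc hb1)
    (setIntegral_mono_on j2 i2 measurableSet_Ioi hb2)

/-- Near the origin the posterior mean is close to zero. -/
theorem exists_shrinkFactor_le (k : ℕ) (hd : 0 < d) (hd1 : d < 1) :
    ∃ C, 0 < C ∧ ∀ c s : ℝ, 0 < c → c ≤ 1 → 0 ≤ s →
      shrinkFactor k d c s ≤ C * (c ^ d * Real.exp (s / 2)) := by
  have h1d : 0 < 1 - d := by linarith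
  refine ⟨(2 ^ (-(k / 2 : ℝ)) * 2 ^ (-d - 1))⁻¹ * (1 / (1 - d) + 1 / d), by positivity,
    fun c s hc hc1 hs ↦ ?_⟩
  have h1 := le_integral_marginalWeight_small (k := k) hd hc hc1 hs
  have h2 := integral_marginalWeight_mul_le (k := k) hd hd1 hc hs
  rw [shrinkFactor]
  have e : (2 ^ (-(k / 2 : ℝ)) * 2 ^ (-d - 1))⁻¹ * (1 / (1 - d) + 1 / d) *
      (c ^ d * Real.exp (s / 2)) = (2 ^ (-(k / 2 : ℝ)) * 2 ^ (-d - 1) *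
        (c ^ (-d) * Real.exp (-s / 2)))⁻¹ * (1 / (1 - d) + 1 / d) := by
    rw [Real.rpow_neg hc.le, neg_div, Real.exp_neg]
    field_simp
  rw [e]
  exact mul_le_mul (inv_anti₀ (by positivity) h1) h2
    (integral_marginalWeight_mul_nonneg s fun u hu ↦ by positivity) (by positivity)

/-- The integral is split at `u = δ`. Above `δ`, `u + c` is comparable to `1 + u`, and the total
power `(1+u)^(-(k/2+d+2))` is shared out: the part `k/2 + d + 1/2` is traded through the exponential
for the same power of `s`, and the remaining `3/2` is integrable with integral `2`. Below `δ`, the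
weight is at most `e^(-s/(2(1+δ)))` and the total mass is `c^(-d)/d`. The extra `1/2` in the power
of `s` is what later absorbs `√s`. -/
theorem integral_marginalWeight_mul_one_sub_le (hd : 0 < d) (hc : 0 < c) (hs : 0 < s)
    {δ : ℝ} (hδ : 0 < δ) :
    ∫ u, marginalWeight k s u * (1 / (1 + u)) ∂lomaxMeasure d c ≤
      (δ / (1 + δ)) ^ (-d - 1) * (2 * (k / 2 + d + 1 / 2)) ^ (k / 2 + d + 1 / 2 : ℝ) * 2 *
        s ^ (-(k / 2 + d + 1 / 2 : ℝ)) + Real.exp (-s / (2 * (1 + δ))) * (c ^ (-d) / d) := by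
  set p : ℝ := k / 2 + d + 1 / 2 with hp
  have hp0 : 0 < p := by positivity
  rw [integral_lomaxMeasure d hc]
  obtain ⟨i1, v1⟩ := integral_rpow_add_Ioi (d := 1 / 2) (c := 1) (by norm_num) one_pos
  obtain ⟨i2, v2⟩ := integral_rpow_add_Ioi hd hc
  set B : ℝ := (δ / (1 + δ)) ^ (-d - 1) * (2 * p) ^ p with hB
  have hB0 : 0 < B := by positivity
  have key : ∀ u, 0 < u → (u + c) ^ (-d - 1) * (marginalWeight k s u * (1 / (1 + u))) ≤
      B * s ^ (-p) * (u + 1) ^ (-(1 / 2 : ℝ) - 1) +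
        Real.exp (-s / (2 * (1 + δ))) * (u + c) ^ (-d - 1) := by
    intro u hu
    have hw : 0 < 1 + u := by linarith
    rcases le_or_gt δ u with h | h
    · refine le_add_of_le_of_nonneg ?_ (by positivity)
      have h1 : (u + c) ^ (-d - 1) ≤ (δ / (1 + δ)) ^ (-d - 1) * (1 + u) ^ (-d - 1) := by
        rw [← Real.mul_rpow (by positivity) hw.le]
        refine Real.rpow_le_rpow_of_nonpos (by positivity) ?_ (by linarith)
        rw [div_mul_eq_mul_div, div_le_iff₀ (by positivity)]
        nlinarith
      have h2 : (1 + u) ^ (-p) * Real.exp (-s / (2 * (1 + u))) ≤ (2 * p) ^ p * s ^ (-p) := by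
        have h3 := rpow_mul_exp_neg_le hp0 (show (0 : ℝ) < 1 / 2 by norm_num)
          (show 0 < s / (1 + u) by positivity)
        rw [Real.div_rpow hs.le hw.le, show p / (1 / 2) = 2 * p by ring] at h3
        rw [Real.rpow_neg hw.le, Real.rpow_neg hs.le, ← div_eq_mul_inv, le_div_iff₀ (by positivity)]
        refine le_trans (le_of_eq ?_) h3
        rw [show -s / (2 * (1 + u)) = -(1 / 2 * (s / (1 + u))) by field_simp]
        field_simp
      calc (u + c) ^ (-d - 1) * (marginalWeight k s u * (1 / (1 + u)))
          ≤ (δ / (1 + δ)) ^ (-d - 1) * (1 + u) ^ (-d - 1) *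
            (marginalWeight k s u * (1 / (1 + u))) := by
            have := marginalWeight_nonneg (k := k) s hu.le
            gcongr
        _ = (δ / (1 + δ)) ^ (-d - 1) * ((1 + u) ^ (-p) * Real.exp (-s / (2 * (1 + u)))) *
            (u + 1) ^ (-(1 / 2 : ℝ) - 1) := by
            have e : (1 + u) ^ (-d - 1) * (1 + u) ^ (-(k / 2 : ℝ)) * (1 + u)⁻¹ =
                (1 + u) ^ (-p) * (1 + u) ^ (-(1 / 2 : ℝ) - 1) := by
              rw [← Real.rpow_neg_one, ← Real.rpow_add hw, ← Real.rpow_add hw, ← Real.rpow_add hw,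
                hp]
              ring_nf
            rw [marginalWeight, add_comm u 1, one_div]
            linear_combination (δ / (1 + δ)) ^ (-d - 1) * Real.exp (-s / (2 * (1 + u))) * e
        _ ≤ (δ / (1 + δ)) ^ (-d - 1) * ((2 * p) ^ p * s ^ (-p)) *
            (u + 1) ^ (-(1 / 2 : ℝ) - 1) := by gcongr
        _ = _ := by rw [hB]; ring
    · refine le_add_of_nonneg_of_le (by positivity) ?_
      rw [mul_comm]
      refine mul_le_mul_of_nonneg_right ?_ (by positivity)
      have h1 : marginalWeight k s u ≤ Real.exp (-s / (2 * (1 + δ))) := by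
        rw [marginalWeight]
        refine (mul_le_of_le_one_left (Real.exp_pos _).le
          (Real.rpow_le_one_of_one_le_of_nonpos (by linarith) (by simp; positivity))).trans ?_
        refine Real.exp_le_exp.2 ?_
        rw [neg_div, neg_div, neg_le_neg_iff]
        exact div_le_div_of_nonneg_left hs.le (by positivity) (by linarith)
      refine (mul_le_of_le_one_right (marginalWeight_nonneg s hu.le) ?_).trans h1
      rw [div_le_one hw]
      linarith
  have hI : IntegrableOn (fun u ↦ B * s ^ (-p) * (u + 1) ^ (-(1 / 2 : ℝ) - 1) +
      Real.exp (-s / (2 * (1 + δ))) * (u + c) ^ (-d - 1)) (Set.Ioi 0) :=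
    (i1.const_mul _).add (i2.const_mul _)
  calc ∫ u in Set.Ioi 0, (u + c) ^ (-d - 1) * (marginalWeight k s u * (1 / (1 + u)))
      ≤ ∫ u in Set.Ioi 0, (B * s ^ (-p) * (u + 1) ^ (-(1 / 2 : ℝ) - 1) +
        Real.exp (-s / (2 * (1 + δ))) * (u + c) ^ (-d - 1)) := by
        refine integral_mono_of_nonneg ?_ hI ?_
        · filter_upwards [ae_restrict_mem measurableSet_Ioi] with u hu
          have hu : 0 < u := hu
          have := marginalWeight_nonneg (k := k) s hu.le
          simp only [Pi.zero_apply]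
          positivity
        · filter_upwards [ae_restrict_mem measurableSet_Ioi] with u hu using key u hu
    _ = _ := by
        rw [integral_add (i1.const_mul _) (i2.const_mul _), integral_const_mul,
          integral_const_mul, v1, v2, Real.one_rpow]
        ring

/-- Far from the origin the posterior mean is close to the observation. -/
theorem exists_one_sub_shrinkFactor_sq_mul_le (k : ℕ) (hd : 0 < d) {δ : ℝ} (hδ : 0 < δ) :
    ∃ C, 0 < C ∧ ∀ c s : ℝ, 0 < c → c ≤ 1 → 0 ≤ s →
      (1 - shrinkFactor k d c s) ^ 2 * s ≤ C + 2 * (1 + δ) ^ 2 * -(d * Real.log c) := by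
  set p : ℝ := k / 2 + d + 1 / 2 with hp
  have hp0 : 0 < p := by positivity
  set D : ℝ := 3 ^ (-(k / 2 + d + 1 : ℝ)) * Real.exp (-1 / 2) with hD
  have hD0 : 0 < D := by positivity
  set B : ℝ := (δ / (1 + δ)) ^ (-d - 1) * (2 * p) ^ p * 2 with hB
  have hB0 : 0 < B := by positivity
  -- `r = 1/(2(1+δ)) - 1/(2(1+δ)²)` is the exponential rate left over when `c^(-d)` is absorbed
  -- above the threshold.
  set r : ℝ := δ / (2 * (1 + δ) ^ 2) with hr
  have hr0 : 0 < r := by positivity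
  set C : ℝ := D⁻¹ * (B + (p / r) ^ p / d) with hC
  have hC0 : 0 < C := by positivity
  refine ⟨1 + C ^ 2, by positivity, fun c s hc hc1 hs ↦ ?_⟩
  have hlog : 0 ≤ -(d * Real.log c) := by
    have := Real.log_nonpos hc.le hc1
    nlinarith
  have h0 := shrinkFactor_nonneg (k := k) hd hc hs
  have h1 := shrinkFactor_le_one (k := k) hd hc hs
  have hle : (1 - shrinkFactor k d c s) ^ 2 * s ≤ s := by
    refine mul_le_of_le_one_left hs ?_
    nlinarith
  have hsq := sq_nonneg C
  by_cases hs1 : s < 1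
  · have : 0 ≤ 2 * (1 + δ) ^ 2 * -(d * Real.log c) := by positivity
    linarith
  -- Below the threshold the trivial bound by `s` suffices. Above it `(1 - κ) √s` is shown to be
  -- bounded.
  by_cases hsc : s < 2 * (1 + δ) ^ 2 * -(d * Real.log c)
  · linarith
  push Not at hs1 hsc
  have hs0 : 0 < s := by linarith
  suffices h : (1 - shrinkFactor k d c s) * Real.sqrt s ≤ C by
    have h2 : 0 ≤ (1 - shrinkFactor k d c s) * Real.sqrt s :=
      mul_nonneg (by linarith) (Real.sqrt_nonneg s)
    have h3 : (1 - shrinkFactor k d c s) ^ 2 * s ≤ C ^ 2 := by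
      calc (1 - shrinkFactor k d c s) ^ 2 * s = ((1 - shrinkFactor k d c s) * Real.sqrt s) ^ 2 := by
            rw [mul_pow, Real.sq_sqrt hs]
        _ ≤ C ^ 2 := by gcongr
    have : 0 ≤ 2 * (1 + δ) ^ 2 * -(d * Real.log c) := by positivity
    linarith
  have hcd : c ^ (-d) ≤ Real.exp (s / (2 * (1 + δ) ^ 2)) := by
    rw [Real.rpow_def_of_pos hc]
    refine Real.exp_le_exp.2 ?_
    rw [le_div_iff₀ (by positivity)]
    linarith
  have hden := le_integral_marginalWeight_large (k := k) hd hc hc1 hs1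
  have hnum := integral_marginalWeight_mul_one_sub_le (k := k) hd hc hs0 hδ
  rw [← hp, ← hB] at hnum
  rw [← hD] at hden
  rw [one_sub_shrinkFactor hd hc hs]
  have hE := rpow_mul_exp_neg_le hp0 hr0 hs0
  have hsp : s ^ p = s ^ (k / 2 + d : ℝ) * Real.sqrt s := by
    rw [Real.sqrt_eq_rpow, ← Real.rpow_add hs0]
  calc (∫ u, marginalWeight k s u ∂lomaxMeasure d c)⁻¹ *
        (∫ u, marginalWeight k s u * (1 / (1 + u)) ∂lomaxMeasure d c) * Real.sqrt s
      ≤ (D * s ^ (-(k / 2 + d : ℝ)))⁻¹ * (B * s ^ (-p) +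
        Real.exp (-s / (2 * (1 + δ))) * (Real.exp (s / (2 * (1 + δ) ^ 2)) / d)) * Real.sqrt s := by
        have := integral_marginalWeight_pos (k := k) hd hc hs
        gcongr
        · exact integral_marginalWeight_mul_nonneg s fun u hu ↦ by positivity
        · refine hnum.trans ?_
          gcongr
    _ = D⁻¹ * (B * (s ^ p * s ^ (-p)) + s ^ p * (Real.exp (-s / (2 * (1 + δ))) *
        Real.exp (s / (2 * (1 + δ) ^ 2))) / d) := by
        rw [Real.rpow_neg hs0.le (k / 2 + d), hsp]
        field_simp
    _ = D⁻¹ * (B + s ^ p * Real.exp (-(r * s)) / d) := by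
        rw [← Real.rpow_add hs0, add_neg_cancel, Real.rpow_zero, mul_one, ← Real.exp_add]
        congr 5
        rw [hr]
        field_simp
        ring
    _ ≤ C := by
        rw [hC]
        gcongr

end ShrinkFactor

end SparseNormalMeans

namespace SparseNormalMeans

/-! ### Risk bounds for the estimator at zero and nonzero means. -/

section UpperBound

variable {k : ℕ} {S : Matrix (Fin k) (Fin k) ℝ} {d : ℝ}

/-- The bound `e^(s/2)` on the shrinkage factor only just fails to be integrable against the
Gaussian. For `s ≤ M` it is at most `e^(1/2) e^((1-1/M)s/2)`, whose expectation is of order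
`M^(k/2)`. For `s > M` the factor is bounded by one and the Gaussian tail gives `e^(-M/4)`. -/
theorem lintegral_shrinkFactor_sq_mul_le (k : ℕ) {d : ℝ} (hd : 0 < d) (hd1 : d < 1) :
    ∃ C, 0 < C ∧ ∀ c M : ℝ, 0 < c → c ≤ 1 → 1 ≤ M →
      ∫⁻ z, ENNReal.ofReal (shrinkFactor k d c (‖z‖ ^ 2) ^ 2 * ‖z‖ ^ 2)
        ∂stdGaussian (EuclideanSpace ℝ (Fin k)) ≤
      ENNReal.ofReal (C * (c ^ d * M ^ (k / 2 + 1 : ℝ) + Real.exp (-M / 4))) := by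
  obtain ⟨C, hC, h⟩ := exists_shrinkFactor_le k hd hd1
  refine ⟨C * Real.exp (1 / 2) + 8 * (1 - 3 / 4) ^ (-(k / 2 : ℝ)), by positivity,
    fun c M hc hc1 hM ↦ ?_⟩
  have hM0 : 0 < M := by linarith
  have key : ∀ s : ℝ, 0 ≤ s → shrinkFactor k d c s ^ 2 * s ≤
      C * Real.exp (1 / 2) * c ^ d * M * Real.exp ((1 - M⁻¹) * s / 2) +
        8 * Real.exp (-M / 4) * Real.exp (3 / 4 * s / 2) := by
    intro s hs
    have h0 := shrinkFactor_nonneg (k := k) hd hc hs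
    have h1 := shrinkFactor_le_one (k := k) hd hc hs
    rcases le_or_gt s M with hsM | hsM
    · refine le_add_of_le_of_nonneg ?_ (by positivity)
      have h2 : Real.exp (s / 2) ≤ Real.exp (1 / 2) * Real.exp ((1 - M⁻¹) * s / 2) := by
        rw [← Real.exp_add]
        refine Real.exp_le_exp.2 ?_
        have : M⁻¹ * s ≤ 1 := by
          rw [inv_mul_le_iff₀ hM0]; linarith
        linarith
      calc shrinkFactor k d c s ^ 2 * s ≤ shrinkFactor k d c s * M := by
            gcongr
            nlinarith
        _ ≤ C * (c ^ d * (Real.exp (1 / 2) * Real.exp ((1 - M⁻¹) * s / 2))) * M := by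
            gcongr
            refine (h c s hc hc1 hs).trans ?_
            gcongr
        _ = _ := by ring
    · refine le_add_of_nonneg_of_le (by positivity) ?_
      have h2 : s ≤ 8 * Real.exp (s / 8) := by
        linarith [Real.add_one_le_exp (s / 8)]
      have h3 : 8 * Real.exp (s / 8) ≤ 8 * Real.exp (-M / 4) * Real.exp (3 / 4 * s / 2) := by
        rw [mul_assoc, ← Real.exp_add]
        gcongr
        linarith
      refine le_trans (mul_le_of_le_one_left hs ?_) (h2.trans h3)
      nlinarith
  calc ∫⁻ z, ENNReal.ofReal (shrinkFactor k d c (‖z‖ ^ 2) ^ 2 * ‖z‖ ^ 2)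
        ∂stdGaussian (EuclideanSpace ℝ (Fin k))
      ≤ ∫⁻ z, (ENNReal.ofReal (C * Real.exp (1 / 2) * c ^ d * M) *
          ENNReal.ofReal (Real.exp ((1 - M⁻¹) * ‖z‖ ^ 2 / 2)) +
        ENNReal.ofReal (8 * Real.exp (-M / 4)) *
          ENNReal.ofReal (Real.exp (3 / 4 * ‖z‖ ^ 2 / 2)))
        ∂stdGaussian (EuclideanSpace ℝ (Fin k)) := by
        refine lintegral_mono fun z ↦ ?_
        rw [← ENNReal.ofReal_mul (by positivity), ← ENNReal.ofReal_mul (by positivity),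
          ← ENNReal.ofReal_add (by positivity) (by positivity)]
        exact ENNReal.ofReal_le_ofReal (key _ (by positivity))
    _ = ENNReal.ofReal (C * Real.exp (1 / 2) * c ^ d * M * (1 - (1 - M⁻¹)) ^ (-(k / 2 : ℝ)) +
        8 * Real.exp (-M / 4) * (1 - 3 / 4) ^ (-(k / 2 : ℝ))) := by
        have hM1 : 1 - M⁻¹ < 1 := by
          have : 0 < M⁻¹ := by positivity
          linarith
        have hM2 : 0 < 1 - (1 - M⁻¹) := by linarith
        rw [lintegral_add_left (by fun_prop), lintegral_const_mul _ (by fun_prop),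
          lintegral_const_mul _ (by fun_prop), lintegral_exp_norm_sq_stdGaussian hM1,
          lintegral_exp_norm_sq_stdGaussian (by norm_num), finrank_euclideanSpace_fin,
          ENNReal.ofReal_add (by positivity) (by positivity),
          ENNReal.ofReal_mul (p := C * Real.exp (1 / 2) * c ^ d * M) (by positivity),
          ENNReal.ofReal_mul (p := 8 * Real.exp (-M / 4)) (by positivity)]
    _ ≤ _ := by
        refine ENNReal.ofReal_le_ofReal ?_
        rw [sub_sub_cancel, Real.inv_rpow hM0.le, Real.rpow_neg hM0.le, inv_inv,
          Real.rpow_add_one hM0.ne']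
        have e1 : 0 ≤ 8 * (1 - 3 / 4 : ℝ) ^ (-(k / 2 : ℝ)) * (c ^ d * (M ^ (k / 2 : ℝ) * M)) := by
          positivity
        have e2 : 0 ≤ C * Real.exp (1 / 2) * Real.exp (-M / 4) := by positivity
        linarith

/-- The error equals `z - (1 - κ)(t + z)`. Young's inequality puts the large factor `1 + δ⁻¹` on the
noise, whose second moment is bounded, and only `1 + δ` on the shrinkage term, which is bounded
pointwise and uniformly in `t`. -/
theorem lintegral_shrink_sub_sq_le (k : ℕ) {d : ℝ} (hd : 0 < d) {δ : ℝ} (hδ : 0 < δ) :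
    ∃ C, 0 < C ∧ ∀ c : ℝ, 0 < c → c ≤ 1 → ∀ t : EuclideanSpace ℝ (Fin k),
      ∫⁻ z, ENNReal.ofReal (‖shrinkFactor k d c (‖t + z‖ ^ 2) • (t + z) - t‖ ^ 2)
        ∂stdGaussian (EuclideanSpace ℝ (Fin k)) ≤
      ENNReal.ofReal (C + 2 * (1 + δ) ^ 3 * -(d * Real.log c)) := by
  obtain ⟨C, hC, h⟩ := exists_one_sub_shrinkFactor_sq_mul_le k hd hδ
  refine ⟨(1 + δ⁻¹) * 4 * (1 - 1 / 2) ^ (-(k / 2 : ℝ)) + (1 + δ) * C, by positivity,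
    fun c hc hc1 t ↦ ?_⟩
  have hlog : 0 ≤ -(d * Real.log c) := by
    have := Real.log_nonpos hc.le hc1
    nlinarith
  set B : ℝ := (1 + δ) * (C + 2 * (1 + δ) ^ 2 * -(d * Real.log c)) with hB
  have hB0 : 0 ≤ B := by positivity
  have key : ∀ z : EuclideanSpace ℝ (Fin k),
      ‖shrinkFactor k d c (‖t + z‖ ^ 2) • (t + z) - t‖ ^ 2 ≤
        (1 + δ⁻¹) * 4 * Real.exp (1 / 2 * ‖z‖ ^ 2 / 2) + B := by
    intro z
    set w := shrinkFactor k d c (‖t + z‖ ^ 2) with hw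
    have h0 : 0 ≤ 1 - w := sub_nonneg.2 (shrinkFactor_le_one hd hc (by positivity))
    have e : w • (t + z) - t = z - (1 - w) • (t + z) := by module
    have hx : ‖w • (t + z) - t‖ ≤ ‖z‖ + (1 - w) * ‖t + z‖ := by
      rw [e]
      refine (norm_sub_le _ _).trans_eq ?_
      rw [norm_smul, Real.norm_of_nonneg h0]
    have h1 := h c (‖t + z‖ ^ 2) hc hc1 (by positivity)
    rw [← hw] at h1
    have h2 : ‖z‖ ^ 2 ≤ 4 * Real.exp (1 / 2 * ‖z‖ ^ 2 / 2) := by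
      linarith [Real.add_one_le_exp (1 / 2 * ‖z‖ ^ 2 / 2)]
    have h3 : ∀ a b : ℝ, (a + b) ^ 2 ≤ (1 + δ⁻¹) * a ^ 2 + (1 + δ) * b ^ 2 := fun a b ↦ by
      have : (1 + δ⁻¹) * a ^ 2 + (1 + δ) * b ^ 2 - (a + b) ^ 2 = (a - δ * b) ^ 2 / δ := by
        field_simp; ring
      have h4 : 0 ≤ (a - δ * b) ^ 2 / δ := by positivity
      linarith
    calc ‖w • (t + z) - t‖ ^ 2 ≤ (‖z‖ + (1 - w) * ‖t + z‖) ^ 2 := by gcongr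
      _ ≤ (1 + δ⁻¹) * ‖z‖ ^ 2 + (1 + δ) * ((1 - w) * ‖t + z‖) ^ 2 := h3 _ _
      _ ≤ (1 + δ⁻¹) * (4 * Real.exp (1 / 2 * ‖z‖ ^ 2 / 2)) + B := by
          rw [mul_pow, hB]
          gcongr
      _ = _ := by ring
  calc ∫⁻ z, ENNReal.ofReal (‖shrinkFactor k d c (‖t + z‖ ^ 2) • (t + z) - t‖ ^ 2)
        ∂stdGaussian (EuclideanSpace ℝ (Fin k))
      ≤ ∫⁻ z, (ENNReal.ofReal ((1 + δ⁻¹) * 4) *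
          ENNReal.ofReal (Real.exp (1 / 2 * ‖z‖ ^ 2 / 2)) + ENNReal.ofReal B)
        ∂stdGaussian (EuclideanSpace ℝ (Fin k)) := by
        refine lintegral_mono fun z ↦ ?_
        rw [← ENNReal.ofReal_mul (by positivity), ← ENNReal.ofReal_add (by positivity) hB0]
        exact ENNReal.ofReal_le_ofReal (key z)
    _ = ENNReal.ofReal ((1 + δ⁻¹) * 4 * (1 - 1 / 2) ^ (-(k / 2 : ℝ)) + B) := by
        rw [lintegral_add_left (by fun_prop), lintegral_const_mul _ (by fun_prop),
          lintegral_exp_norm_sq_stdGaussian (by norm_num), finrank_euclideanSpace_fin,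
          lintegral_const, measure_univ, mul_one, ENNReal.ofReal_add (by positivity) hB0,
          ENNReal.ofReal_mul (p := (1 + δ⁻¹) * 4) (by positivity)]
    _ = _ := by
        congr 1
        rw [hB]
        ring

theorem measurable_eigPosteriorMean (hS : S.PosDef) {c : ℝ} (hd : 0 < d) (hc : 0 < c) :
    Measurable (eigPosteriorMean S d c) := by
  obtain ⟨A, hA, hA'⟩ := exists_whitening hS
  have e : eigPosteriorMean S d c = fun x ↦ shrinkFactor k d c (‖A.symm x‖ ^ 2) • x := by
    funext x
    have := eigPosteriorMean_map hS hd hc hA hA' (A.symm x)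
    rwa [A.apply_symm_apply] at this
  rw [e]
  have := measurable_shrinkFactor k hd hc
  fun_prop

theorem measurable_eigEstimator (hS : S.PosDef) {c : ℝ} (hd : 0 < d) (hc : 0 < c) (n : ℕ) :
    Measurable (eigEstimator S d c n) :=
  measurable_pi_lambda _ fun i ↦ (measurable_eigPosteriorMean hS hd hc).comp (measurable_pi_apply i)

theorem measurable_mahalSq : Measurable (mahalSq S) := by
  unfold mahalSq
  refine Continuous.measurable ?_
  unfold dotProduct Matrix.mulVec dotProduct
  fun_prop

theorem coordRisk_eigEstimator (hS : S.PosDef) {c : ℝ} (hd : 0 < d) (hc : 0 < c)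
    {A : EuclideanSpace ℝ (Fin k) ≃L[ℝ] EuclideanSpace ℝ (Fin k)}
    (hA : ∀ x, mahalSq S (A x) = ‖x‖ ^ 2)
    (hA' : ∀ v, multivariateGaussian (A v) S =
        (stdGaussian (EuclideanSpace ℝ (Fin k))).map (fun x ↦ A (v + x)))
    {n : ℕ} (θ : Fin n → EuclideanSpace ℝ (Fin k)) (i : Fin n) :
    coordRisk S (eigEstimator S d c n) θ i =
      ∫⁻ z, ENNReal.ofReal (‖shrinkFactor k d c (‖A.symm (θ i) + z‖ ^ 2) • (A.symm (θ i) + z) -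
        A.symm (θ i)‖ ^ 2) ∂stdGaussian (EuclideanSpace ℝ (Fin k)) := by
  have hm := measurable_eigPosteriorMean hS hd hc
  have hq := measurable_mahalSq (S := S)
  have hmp := measurePreserving_eval (fun j ↦ multivariateGaussian (θ j) S) i
  have hf : Measurable fun x ↦ ENNReal.ofReal (mahalSq S (eigPosteriorMean S d c x - θ i)) :=
    (hq.comp (hm.sub_const _)).ennreal_ofReal
  have h1 : coordRisk S (eigEstimator S d c n) θ i =
      ∫⁻ x, ENNReal.ofReal (mahalSq S (eigPosteriorMean S d c x - θ i))
        ∂multivariateGaussian (θ i) S := by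
    rw [← hmp.lintegral_comp hf]
    rfl
  have h2 := hA' (A.symm (θ i))
  rw [A.apply_symm_apply] at h2
  rw [h1, h2, lintegral_map hf (by fun_prop)]
  refine lintegral_congr fun z ↦ ?_
  rw [eigPosteriorMean_map hS hd hc hA hA', ← hA (_ • _ - _), map_sub, map_smul,
    A.apply_symm_apply]

theorem exists_zeroRisk_le (hS : S.PosDef) (hd : 0 < d) (hd1 : d < 1) :
    ∃ C, 0 < C ∧ ∀ c M : ℝ, 0 < c → c ≤ 1 → 1 ≤ M →
      ∀ (n : ℕ) (θ : Fin n → EuclideanSpace ℝ (Fin k)), zeroRisk S (eigEstimator S d c n) θ ≤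
        ENNReal.ofReal (n * (C * (c ^ d * M ^ (k / 2 + 1 : ℝ) + Real.exp (-M / 4)))) := by
  obtain ⟨A, hA, hA'⟩ := exists_whitening hS
  obtain ⟨C, hC, h⟩ := lintegral_shrinkFactor_sq_mul_le k hd hd1
  refine ⟨C, hC, fun c M hc hc1 hM n θ ↦ ?_⟩
  have hb : ∀ i, θ i = 0 → coordRisk S (eigEstimator S d c n) θ i ≤
      ENNReal.ofReal (C * (c ^ d * M ^ (k / 2 + 1 : ℝ) + Real.exp (-M / 4))) := fun i hi ↦ by
    rw [coordRisk_eigEstimator hS hd hc hA hA', hi, map_zero]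
    refine le_trans (le_of_eq (lintegral_congr fun z ↦ ?_)) (h c M hc hc1 hM)
    rw [zero_add, sub_zero, norm_smul, mul_pow, Real.norm_eq_abs, sq_abs]
  classical
  rw [zeroRisk, ENNReal.ofReal_mul (by positivity), ENNReal.ofReal_natCast]
  refine (Finset.sum_le_card_nsmul _ _ _ fun i hi ↦ hb i (by simpa using hi)).trans ?_
  rw [nsmul_eq_mul]
  gcongr
  simpa using Finset.card_filter_le (Finset.univ : Finset (Fin n)) (fun i ↦ θ i = 0)

theorem exists_nonzeroRisk_le (hS : S.PosDef) (hd : 0 < d) {δ : ℝ} (hδ : 0 < δ) :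
    ∃ C, 0 < C ∧ ∀ c : ℝ, 0 < c → c ≤ 1 →
      ∀ (n q : ℕ), ∀ θ ∈ nearlyBlack k n q, nonzeroRisk S (eigEstimator S d c n) θ ≤
        ENNReal.ofReal (q * (C + 2 * (1 + δ) ^ 3 * -(d * Real.log c))) := by
  obtain ⟨A, hA, hA'⟩ := exists_whitening hS
  obtain ⟨C, hC, h⟩ := lintegral_shrink_sub_sq_le k hd hδ
  refine ⟨C, hC, fun c hc hc1 n q θ hθ ↦ ?_⟩
  classical
  rw [nonzeroRisk, ENNReal.ofReal_mul (by positivity), ENNReal.ofReal_natCast]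
  refine (Finset.sum_le_card_nsmul _ _ (ENNReal.ofReal (C + 2 * (1 + δ) ^ 3 * -(d * Real.log c)))
    fun i _ ↦ ?_).trans ?_
  · rw [coordRisk_eigEstimator hS hd hc hA hA']
    exact h c hc hc1 _
  · rw [nsmul_eq_mul]
    gcongr
    have : {i | θ i ≠ 0}.ncard ≤ q := hθ
    rw [← Set.ncard_coe_finset]
    simpa using this

theorem totalRisk_eq_add {n : ℕ}
    (T : (Fin n → EuclideanSpace ℝ (Fin k)) → (Fin n → EuclideanSpace ℝ (Fin k)))
    (θ : Fin n → EuclideanSpace ℝ (Fin k)) :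
    totalRisk S T θ = zeroRisk S T θ + nonzeroRisk S T θ := by
  classical
  rw [totalRisk, zeroRisk, nonzeroRisk, ← Finset.sum_filter_add_sum_filter_not _ (fun i ↦ θ i = 0)]

end UpperBound

end SparseNormalMeans

namespace SparseNormalMeans

/-! ### Bayes lower bound for one spike per block. -/

section LowerBound

/-- Changing one factor of a product measure by a density changes the product by this density. -/
theorem pi_eq_withDensity_of_eq_withDensity {ι X : Type*} [Fintype ι] [MeasurableSpace X]
    {μ ν : ι → Measure X} [∀ i, SigmaFinite (μ i)] [∀ i, SigmaFinite (ν i)] (i : ι) {f : X → ℝ≥0∞}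
    (hf : Measurable f) (hi : ν i = (μ i).withDensity f) (hne : ∀ j, j ≠ i → ν j = μ j) :
    Measure.pi ν = (Measure.pi μ).withDensity fun x ↦ f (x i) := by
  classical
  refine Measure.pi_eq fun s hs ↦ ?_
  have hf' : Measurable fun x : ι → X ↦ f (x i) := hf.comp (measurable_pi_apply i)
  have hmap : ∀ M : Measure (ι → X), ∫⁻ x, f (x i) ∂M = ∫⁻ y, f y ∂M.map (Function.eval i) :=
    fun M ↦ (lintegral_map hf (measurable_pi_apply i)).symm
  rw [withDensity_apply _ (MeasurableSet.univ_pi hs), Measure.restrict_pi_pi, hmap,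
    Measure.pi_map_eval, lintegral_smul_measure, smul_eq_mul,
    ← Finset.prod_erase_mul _ _ (Finset.mem_univ i), hi, withDensity_apply _ (hs i)]
  congr 1
  refine Finset.prod_congr rfl fun j hj ↦ ?_
  rw [hne j (Finset.ne_of_mem_erase hj), Measure.restrict_apply_univ]

variable {E : Type*} [NormedAddCommGroup E]

/-- The configuration with the vector `v` at the place `I b` of each block `b`, and zeros at the
other places. -/
noncomputable def spikeConfig {ι : Type*} {q m : ℕ} (e : Fin q × Fin m ↪ ι) (v : E)
    (I : Fin q → Fin m) : ι → E :=
  Function.extend e (fun p ↦ if p.2 = I p.1 then v else 0) 0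

/-- Fixing the spikes of the other blocks leaves a one-spike problem in block `b`, over a single
background `θ` that serves every place `i`. -/
theorem spikeConfig_funSplitAt_symm {ι : Type*} [DecidableEq ι] {q m : ℕ} (e : Fin q × Fin m ↪ ι)
    (v : E) (b : Fin q) (g : {j // j ≠ b} → Fin m) :
    ∃ θ : ι → E, (∀ i, θ (e (b, i)) = 0) ∧
      ∀ i, spikeConfig e v ((Equiv.funSplitAt b (Fin m)).symm (i, g)) =
        Function.update θ (e (b, i)) v := by
  refine ⟨Function.extend e (fun p ↦ if h : p.1 = b then 0 else
    if p.2 = g ⟨p.1, h⟩ then v else 0) 0, fun i ↦ ?_, fun i ↦ ?_⟩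
  · rw [e.injective.extend_apply]; simp
  · funext j
    by_cases hj : ∃ p, e p = j
    · obtain ⟨⟨b', i'⟩, rfl⟩ := hj
      rw [spikeConfig, e.injective.extend_apply]
      by_cases h : b' = b
      · subst h
        by_cases hi : i' = i
        · subst hi; simp [Equiv.funSplitAt, Equiv.piSplitAt]
        · rw [Function.update_of_ne (fun h ↦ hi (by simpa using e.injective h)),
            e.injective.extend_apply]
          simp [Equiv.funSplitAt, Equiv.piSplitAt, hi]
      · rw [Function.update_of_ne (fun h' ↦ h (congrArg Prod.fst (e.injective h'))),
          e.injective.extend_apply]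
        simp [Equiv.funSplitAt, Equiv.piSplitAt, h]
    · rw [spikeConfig, Function.extend_apply' _ _ _ hj, Function.update_of_ne,
        Function.extend_apply' _ _ _ hj]
      exact fun h ↦ hj ⟨_, h.symm⟩

variable [InnerProductSpace ℝ E]

/-- The Bayes risk of guessing the place of the vector `v` among zeros, with weights `w`. -/
theorem sum_mul_norm_sub_sq_ge {m : ℕ} {w : Fin m → ℝ} (hw : ∀ i, 0 < w i) (T : Fin m → E)
    (v : E) :
    ‖v‖ ^ 2 * ∑ i, w i ≤ ∑ i, w i * ∑ j, ‖T j - (if j = i then v else 0)‖ ^ 2 +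
      ‖v‖ ^ 2 * ∑ i, w i * (w i / ∑ j, w j) := by
  rcases isEmpty_or_nonempty (Fin m) with h | h
  · simp
  set W := ∑ i, w i with hW
  have hW0 : 0 < W := Finset.sum_pos (fun i _ ↦ hw i) Finset.univ_nonempty
  simp_rw [Finset.mul_sum]
  rw [Finset.sum_comm, ← Finset.sum_add_distrib, hW, Finset.mul_sum]
  refine Finset.sum_le_sum fun j _ ↦ ?_
  have e : ∀ i, w i * ‖T j - (if j = i then v else 0)‖ ^ 2 =
      w i * ‖T j‖ ^ 2 + if j = i then w j * (‖v‖ ^ 2 - 2 * inner ℝ (T j) v) else 0 := fun i ↦ by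
    split_ifs with hij
    · rw [@norm_sub_sq_real, hij]; ring
    · simp
  simp_rw [e]
  rw [Finset.sum_add_distrib, ← Finset.sum_mul, Finset.sum_ite_eq, if_pos (Finset.mem_univ j),
    ← hW]
  -- This is `W ‖T j - (w j / W) • v‖²`, the excess risk over the Bayes estimate `(w j / W) • v` at
  -- place `j`.
  have h1 : 0 ≤ ‖W • T j - w j • v‖ ^ 2 / W := by positivity
  have h2 : ‖W • T j - w j • v‖ ^ 2 / W =
      W * ‖T j‖ ^ 2 - 2 * w j * inner ℝ (T j) v + ‖v‖ ^ 2 * (w j * (w j / W)) := by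
    rw [@norm_sub_sq_real, norm_smul, norm_smul, real_inner_smul_left, real_inner_smul_right,
      Real.norm_of_nonneg hW0.le, Real.norm_of_nonneg (hw j).le]
    field_simp
  linarith

/-- The likelihood ratio of the mean `v` against the mean zero. -/
noncomputable def spikeRatio (v x : E) : ℝ := Real.exp (inner ℝ v x - ‖v‖ ^ 2 / 2)

theorem spikeRatio_pos (v x : E) : 0 < spikeRatio v x := Real.exp_pos _

/-- The posterior probability of the place `i` of the spike `v`. -/
noncomputable def spikePosterior {m : ℕ} (v : E) (x : Fin m → E) (i : Fin m) : ℝ :=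
  spikeRatio v (x i) / ∑ j, spikeRatio v (x j)

theorem spikePosterior_nonneg {m : ℕ} (v : E) (x : Fin m → E) (i : Fin m) :
    0 ≤ spikePosterior v x i :=
  div_nonneg (spikeRatio_pos v _).le (Finset.sum_nonneg fun _ _ ↦ (spikeRatio_pos v _).le)

variable [FiniteDimensional ℝ E] [MeasurableSpace E] [BorelSpace E]

/-- The law of independent normal vectors with means `θ i` and identity covariance. -/
noncomputable def shiftedLaw {ι : Type*} [Fintype ι] (θ : ι → E) : Measure (ι → E) :=
  Measure.pi fun i ↦ (stdGaussian E).map fun x ↦ θ i + x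

instance isProbabilityMeasure_shift (v : E) :
    IsProbabilityMeasure ((stdGaussian E).map fun x ↦ v + x) :=
  Measure.isProbabilityMeasure_map (by fun_prop)

instance isProbabilityMeasure_shiftedLaw {ι : Type*} [Fintype ι] (θ : ι → E) :
    IsProbabilityMeasure (shiftedLaw θ) := by
  unfold shiftedLaw; infer_instance

theorem measurable_spikeRatio (v : E) : Measurable (spikeRatio v) := by
  unfold spikeRatio; fun_prop

theorem shiftedLaw_update {ι : Type*} [Fintype ι] [DecidableEq ι] {θ : ι → E} {i : ι}
    (hi : θ i = 0) (v : E) :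
    shiftedLaw (Function.update θ i v) =
      (shiftedLaw θ).withDensity fun x ↦ ENNReal.ofReal (spikeRatio v (x i)) := by
  refine pi_eq_withDensity_of_eq_withDensity (μ := fun j ↦ (stdGaussian E).map fun x ↦ θ j + x)
    (ν := fun j ↦ (stdGaussian E).map fun x ↦ Function.update θ i v j + x) i
    (f := fun x ↦ ENNReal.ofReal (spikeRatio v x)) (measurable_spikeRatio v).ennreal_ofReal ?_
    fun j hj ↦ ?_
  · simp only [Function.update_self, hi, zero_add, Measure.map_id']
    exact stdGaussian_map_add_left v
  · simp only [Function.update_of_ne hj]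

theorem measurable_spikePosterior {m : ℕ} (v : E) (i : Fin m) :
    Measurable fun x : Fin m → E ↦ spikePosterior v x i := by
  have := measurable_spikeRatio v
  unfold spikePosterior
  fun_prop

/-- All `m` hypotheses are expressed through their likelihood ratios against the common law without
a spike, and the pointwise Bayes bound is integrated. The estimator may depend on every coordinate.
The loss term is added on the right because subtraction in `ℝ≥0∞` is truncated. -/
theorem sum_risk_spike_ge {ι : Type*} [Fintype ι] [DecidableEq ι] {m : ℕ} (e : Fin m ↪ ι)
    {θ : ι → E} (hθ : ∀ i, θ (e i) = 0) (v : E) {T : (ι → E) → (ι → E)} (hT : Measurable T) :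
    m * ENNReal.ofReal (‖v‖ ^ 2) ≤
      ∑ i, ∑ j, ∫⁻ x, ENNReal.ofReal (‖T x (e j) - Function.update θ (e i) v (e j)‖ ^ 2)
        ∂shiftedLaw (Function.update θ (e i) v) +
      ENNReal.ofReal (‖v‖ ^ 2) * ∑ i, ∫⁻ x, ENNReal.ofReal (spikePosterior v (fun j ↦ x (e j)) i)
        ∂shiftedLaw (Function.update θ (e i) v) := by
  have hr := measurable_spikeRatio v
  have hT' : ∀ j, Measurable fun x ↦ T x (e j) := fun j ↦ (measurable_pi_apply _).comp hT
  have hp : ∀ i, Measurable fun x : ι → E ↦ spikePosterior v (fun j ↦ x (e j)) i := fun i ↦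
    (measurable_spikePosterior v i).comp
      (by fun_prop : Measurable fun (x : ι → E) (j : Fin m) ↦ x (e j))
  have hd : ∀ i, ∀ f : (ι → E) → ℝ≥0∞, Measurable f →
      ∫⁻ x, f x ∂shiftedLaw (Function.update θ (e i) v) =
      ∫⁻ x, ENNReal.ofReal (spikeRatio v (x (e i))) * f x ∂shiftedLaw θ := fun i f hf ↦ by
    rw [shiftedLaw_update (hθ i), lintegral_withDensity_eq_lintegral_mul _ (by fun_prop) hf]
    rfl
  have h1 : ∀ i, ∫⁻ x, ENNReal.ofReal (spikeRatio v (x (e i))) ∂shiftedLaw θ = 1 := fun i ↦ by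
    have := hd i (fun _ ↦ 1) measurable_const
    simpa using this.symm
  have hu : ∀ i j, Function.update θ (e i) v (e j) = if j = i then v else 0 := fun i j ↦ by
    by_cases h : j = i
    · simp [h]
    · rw [Function.update_of_ne (fun h' ↦ h (e.injective h')), hθ, if_neg h]
  have hri : ∀ i, Measurable fun x : ι → E ↦ spikeRatio v (x (e i)) := fun i ↦
    hr.comp (measurable_pi_apply _)
  have hsum : Measurable fun x : ι → E ↦ ∑ i, ENNReal.ofReal (spikeRatio v (x (e i))) :=
    Finset.measurable_sum _ fun i _ ↦ (hri i).ennreal_ofReal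
  calc m * ENNReal.ofReal (‖v‖ ^ 2)
      = ∫⁻ x, ENNReal.ofReal (‖v‖ ^ 2 * ∑ i, spikeRatio v (x (e i))) ∂shiftedLaw θ := by
        simp_rw [ENNReal.ofReal_mul (sq_nonneg ‖v‖),
          ENNReal.ofReal_sum_of_nonneg fun i _ ↦ (spikeRatio_pos v _).le]
        rw [lintegral_const_mul _ hsum, lintegral_finsetSum _ fun i _ ↦ (hri i).ennreal_ofReal]
        simp_rw [h1]
        simp [mul_comm]
    _ ≤ ∫⁻ x, (∑ i, ∑ j, ENNReal.ofReal (spikeRatio v (x (e i))) *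
          ENNReal.ofReal (‖T x (e j) - (if j = i then v else 0)‖ ^ 2) +
        ENNReal.ofReal (‖v‖ ^ 2) * ∑ i, ENNReal.ofReal (spikeRatio v (x (e i))) *
          ENNReal.ofReal (spikePosterior v (fun j ↦ x (e j)) i)) ∂shiftedLaw θ := by
        refine lintegral_mono fun x ↦ ?_
        refine (ENNReal.ofReal_le_ofReal (sum_mul_norm_sub_sq_ge
          (fun i ↦ spikeRatio_pos v (x (e i))) (fun j ↦ T x (e j)) v)).trans (le_of_eq ?_)
        have hp0 := fun i ↦ spikePosterior_nonneg v (fun j ↦ x (e j)) i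
        have hr0 := fun i ↦ (spikeRatio_pos v (x (e i))).le
        change ENNReal.ofReal (∑ i, spikeRatio v (x (e i)) *
          ∑ j, ‖T x (e j) - (if j = i then v else 0)‖ ^ 2 + ‖v‖ ^ 2 * ∑ i, spikeRatio v (x (e i)) *
            spikePosterior v (fun j ↦ x (e j)) i) = _
        rw [ENNReal.ofReal_add
          (Finset.sum_nonneg fun i _ ↦
            mul_nonneg (hr0 i) (Finset.sum_nonneg fun _ _ ↦ by positivity))
          (mul_nonneg (sq_nonneg _) (Finset.sum_nonneg fun i _ ↦ mul_nonneg (hr0 i) (hp0 i))),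
          ENNReal.ofReal_sum_of_nonneg fun i _ ↦
            mul_nonneg (hr0 i) (Finset.sum_nonneg fun _ _ ↦ by positivity),
          ENNReal.ofReal_mul (sq_nonneg _),
          ENNReal.ofReal_sum_of_nonneg fun i _ ↦ mul_nonneg (hr0 i) (hp0 i)]
        congr 1
        · refine Finset.sum_congr rfl fun i _ ↦ ?_
          rw [Finset.mul_sum, ENNReal.ofReal_sum_of_nonneg fun j _ ↦
            mul_nonneg (hr0 i) (by positivity)]
          simp_rw [ENNReal.ofReal_mul (hr0 i)]
        · congr 1
          refine Finset.sum_congr rfl fun i _ ↦ ?_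
          rw [← ENNReal.ofReal_mul (hr0 i)]
    _ = _ := by
        rw [lintegral_add_left (by fun_prop), lintegral_finsetSum _ (by fun_prop),
          lintegral_const_mul _ (by fun_prop), lintegral_finsetSum _ (by fun_prop)]
        congr 1
        · refine Finset.sum_congr rfl fun i _ ↦ ?_
          rw [lintegral_finsetSum _ (by fun_prop)]
          refine Finset.sum_congr rfl fun j _ ↦ ?_
          rw [hd i _ (by fun_prop), hu]
        · congr 1
          exact Finset.sum_congr rfl fun i _ ↦ (hd i _ (hp i).ennreal_ofReal).symm

theorem stdGaussian_map_inner {u : E} (hu : ‖u‖ = 1) :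
    (stdGaussian E).map (fun x ↦ inner ℝ u x) = gaussianReal 0 1 := by
  have h := IsGaussian.map_eq_gaussianReal (μ := stdGaussian E) (innerSL ℝ u)
  rw [integral_strongDual_stdGaussian, variance_dual_stdGaussian, innerSL_apply_norm, hu] at h
  simpa using h

/-- An upper bound for the posterior probability of the true place of a spike of length `a` among
`m` places. -/
noncomputable def spikeBound (a g t : ℝ) (m : ℕ) : ℝ≥0∞ :=
  gaussianReal 0 1 (Set.Ici g) + gaussianReal 0 1 (Set.Iio t) ^ (m - 1) +
    ENNReal.ofReal (Real.exp (a * (a + g - t)))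

/-- Three cases, one for each term of `spikeBound`: the noise at the true place is at least `g`; all
`m - 1` competitors project below `t`; or some competitor reaches `t` while the true place stays
below `a + g`, and its likelihood ratio alone forces the posterior probability down to
`e^(a(a+g-t))`. -/
theorem lintegral_spikePosterior_le {ι : Type*} [Fintype ι] [DecidableEq ι] {m : ℕ}
    (e : Fin m ↪ ι) {θ : ι → E} (hθ : ∀ i, θ (e i) = 0) {u : E} (hu : ‖u‖ = 1) {a : ℝ} (ha : 0 < a)
    (g t : ℝ) (i : Fin m) :
    ∫⁻ x, ENNReal.ofReal (spikePosterior (a • u) (fun j ↦ x (e j)) i)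
        ∂shiftedLaw (Function.update θ (e i) (a • u)) ≤ spikeBound a g t m := by
  set P := shiftedLaw (Function.update θ (e i) (a • u)) with hP
  set B : Set (ι → E) := {x | a + g ≤ inner ℝ u (x (e i))} with hB
  set D : Set (ι → E) := (((Finset.univ.erase i).map e : Finset ι) : Set ι).pi
    fun _ ↦ {z | inner ℝ u z < t} with hD
  have hBm : MeasurableSet B := measurableSet_le (by fun_prop) (by fun_prop)
  have htm : MeasurableSet {z : E | inner ℝ u z < t} :=
    measurableSet_lt (by fun_prop) (by fun_prop)
  have hDm : MeasurableSet D := MeasurableSet.pi (Finset.countable_toSet _) fun _ _ ↦ htm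
  have key : ∀ x, ENNReal.ofReal (spikePosterior (a • u) (fun j ↦ x (e j)) i) ≤
      B.indicator 1 x + D.indicator 1 x + ENNReal.ofReal (Real.exp (a * (a + g - t))) := by
    intro x
    have hle : spikePosterior (a • u) (fun j ↦ x (e j)) i ≤ 1 := by
      refine div_le_one_of_le₀ ?_ (Finset.sum_nonneg fun j _ ↦ (spikeRatio_pos _ _).le)
      exact Finset.single_le_sum (f := fun j ↦ spikeRatio (a • u) (x (e j)))
        (fun j _ ↦ (spikeRatio_pos _ _).le) (Finset.mem_univ i)
    by_cases hxB : x ∈ B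
    · rw [Set.indicator_of_mem hxB, add_assoc]
      exact le_add_of_le_of_nonneg (by simpa using hle) (by positivity)
    by_cases hxD : x ∈ D
    · rw [Set.indicator_of_mem hxD, add_assoc]
      exact le_add_of_nonneg_of_le (by positivity)
        (le_add_of_le_of_nonneg (by simpa using hle) (by positivity))
    refine le_add_of_nonneg_of_le (by positivity) (ENNReal.ofReal_le_ofReal ?_)
    obtain ⟨j, hj⟩ : ∃ j, t ≤ inner ℝ u (x (e j)) := by
      by_contra! h
      refine hxD fun l hl ↦ ?_
      obtain ⟨j, -, rfl⟩ := Finset.mem_map.1 (Finset.mem_coe.1 hl)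
      exact h j
    have hx : inner ℝ u (x (e i)) < a + g := not_le.1 hxB
    calc spikePosterior (a • u) (fun j ↦ x (e j)) i
        ≤ spikeRatio (a • u) (x (e i)) / spikeRatio (a • u) (x (e j)) := by
          refine div_le_div_of_nonneg_left (spikeRatio_pos _ _).le (spikeRatio_pos _ _) ?_
          exact Finset.single_le_sum (f := fun j ↦ spikeRatio (a • u) (x (e j)))
            (fun j _ ↦ (spikeRatio_pos _ _).le) (Finset.mem_univ j)
      _ ≤ Real.exp (a * (a + g - t)) := by
          rw [spikeRatio, spikeRatio, ← Real.exp_sub]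
          refine Real.exp_le_exp.2 ?_
          rw [real_inner_smul_left, real_inner_smul_left]
          nlinarith
  have hPB : P B = gaussianReal 0 1 (Set.Ici g) := by
    have h1 : P B = ((stdGaussian E).map fun x ↦ a • u + x) {z | a + g ≤ inner ℝ u z} := by
      have h := (measurePreserving_eval (fun j ↦ (stdGaussian E).map
        fun x ↦ Function.update θ (e i) (a • u) j + x) (e i)).measure_preimage
        (measurableSet_le (measurable_const (a := a + g))
          (by fun_prop : Measurable fun z : E ↦ inner ℝ u z)).nullMeasurableSet
      rw [Function.update_self] at h
      exact h
    rw [h1, Measure.map_apply (by fun_prop) (measurableSet_le (by fun_prop) (by fun_prop)),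
      ← stdGaussian_map_inner hu, Measure.map_apply (by fun_prop) measurableSet_Ici]
    congr 1
    ext z
    simp [inner_add_right, real_inner_smul_right, hu]
  have hPD : P D = gaussianReal 0 1 (Set.Iio t) ^ (m - 1) := by
    rw [hP, hD, shiftedLaw, Measure.pi_pi_finset, Finset.prod_map]
    have : ∀ j ∈ Finset.univ.erase i, ((stdGaussian E).map
        fun x ↦ Function.update θ (e i) (a • u) (e j) + x) {z | inner ℝ u z < t} =
        gaussianReal 0 1 (Set.Iio t) := fun j hj ↦ by
      rw [Function.update_of_ne fun h ↦ Finset.ne_of_mem_erase hj (e.injective h), hθ]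
      simp only [zero_add, Measure.map_id']
      rw [← stdGaussian_map_inner hu, Measure.map_apply (by fun_prop) measurableSet_Iio]
      rfl
    rw [Finset.prod_congr rfl this]
    simp
  refine (lintegral_mono key).trans (le_of_eq ?_)
  rw [lintegral_add_right _ measurable_const, lintegral_add_right _ (measurable_one.indicator hDm),
    lintegral_indicator_one hBm, lintegral_indicator_one hDm, lintegral_const, measure_univ, mul_one,
    hPB, hPD, spikeBound]

/-- The supremum dominates the average over all placements. For each block the average is taken
first over its own spike with the others frozen, where the one-spike bound applies, and the blocks
are then added up. -/
theorem minimax_spikeConfig_ge {ι : Type*} [Fintype ι] {q m : ℕ} (hm : 0 < m)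
    (e : Fin q × Fin m ↪ ι) {u : E} (hu : ‖u‖ = 1) {a : ℝ} (ha : 0 < a) (g t : ℝ)
    {T : (ι → E) → (ι → E)} (hT : Measurable T) :
    q * ENNReal.ofReal (a ^ 2) ≤
      (⨆ I, ∑ j, ∫⁻ x, ENNReal.ofReal (‖T x j - spikeConfig e (a • u) I j‖ ^ 2)
        ∂shiftedLaw (spikeConfig e (a • u) I)) +
      q * (ENNReal.ofReal (a ^ 2) * spikeBound a g t m) := by
  classical
  set v := a • u with hv
  have hnv : ‖v‖ ^ 2 = a ^ 2 := by
    rw [hv, norm_smul, hu, mul_one, Real.norm_of_nonneg ha.le]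
  set R : (Fin q → Fin m) → ι → ℝ≥0∞ := fun I j ↦
    ∫⁻ x, ENNReal.ofReal (‖T x j - spikeConfig e v I j‖ ^ 2) ∂shiftedLaw (spikeConfig e v I)
    with hR
  set N : ℝ≥0∞ := ((Fintype.card (Fin q → Fin m) : ℕ) : ℝ≥0∞) with hN
  have hN0 : N ≠ 0 := by
    have : Nonempty (Fin m) := ⟨⟨0, hm⟩⟩
    rw [hN, Nat.cast_ne_zero]
    exact Fintype.card_ne_zero
  have hNt : N ≠ ∞ := ENNReal.natCast_ne_top _
  have block : ∀ b, N * ENNReal.ofReal (a ^ 2) ≤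
      ∑ I, ∑ i, R I (e (b, i)) + N * (ENNReal.ofReal (a ^ 2) * spikeBound a g t m) := by
    intro b
    have hcard : N = ∑ _g : {j // j ≠ b} → Fin m, (m : ℝ≥0∞) := by
      rw [hN, Fintype.card_congr (Equiv.funSplitAt b (Fin m)), Fintype.card_prod]
      simp [mul_comm]
    rw [← (Equiv.funSplitAt b (Fin m)).symm.sum_comp, Fintype.sum_prod_type_right, hcard,
      Finset.sum_mul, Finset.sum_mul, ← Finset.sum_add_distrib]
    refine Finset.sum_le_sum fun g' _ ↦ ?_
    obtain ⟨θ, hθ, hθ'⟩ := spikeConfig_funSplitAt_symm e v b g'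
    let e' : Fin m ↪ ι := ⟨fun i ↦ e (b, i), fun i j h ↦ by simpa using e.injective h⟩
    have h := sum_risk_spike_ge e' (θ := θ) hθ v hT
    rw [hnv] at h
    refine h.trans ?_
    simp only [hR, hθ']
    gcongr ?_ + ?_
    · exact le_rfl
    · rw [mul_left_comm]
      gcongr
      refine (Finset.sum_le_card_nsmul _ _ (spikeBound a g t m) fun i _ ↦
        lintegral_spikePosterior_le e' hθ hu ha g t i).trans ?_
      simp
  have hsum : N * (q * ENNReal.ofReal (a ^ 2)) ≤
      N * ((⨆ I, ∑ j, R I j) + q * (ENNReal.ofReal (a ^ 2) * spikeBound a g t m)) := by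
    calc N * (q * ENNReal.ofReal (a ^ 2)) = ∑ _b : Fin q, N * ENNReal.ofReal (a ^ 2) := by
          simp [mul_left_comm]
      _ ≤ ∑ b : Fin q, (∑ I, ∑ i, R I (e (b, i)) +
          N * (ENNReal.ofReal (a ^ 2) * spikeBound a g t m)) :=
          Finset.sum_le_sum fun b _ ↦ block b
      _ = ∑ I, ∑ p, R I (e p) + N * (q * (ENNReal.ofReal (a ^ 2) * spikeBound a g t m)) := by
          rw [Finset.sum_add_distrib, Finset.sum_comm]
          simp_rw [Fintype.sum_prod_type]
          simp [mul_left_comm]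
      _ ≤ ∑ _I : Fin q → Fin m, (⨆ I, ∑ j, R I j) +
          N * (q * (ENNReal.ofReal (a ^ 2) * spikeBound a g t m)) := by
          gcongr with I
          refine le_trans ?_ (le_iSup (fun I ↦ ∑ j, R I j) I)
          rw [← Finset.sum_map Finset.univ e (R I)]
          exact Finset.sum_le_univ_sum_of_nonneg fun _ ↦ by positivity
      _ = _ := by
          rw [mul_add]
          simp [hN]
  -- The number `N` of placements is cancelled, turning sums into averages.
  exact (ENNReal.mul_le_mul_iff_right hN0 hNt).1 hsum

end LowerBound

end SparseNormalMeans

namespace SparseNormalMeans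

/-! ### Transfer to the minimax risk, and the choice of spike length. -/

section MinimaxLower

variable {k : ℕ} {S : Matrix (Fin k) (Fin k) ℝ}

theorem totalRisk_map {A : EuclideanSpace ℝ (Fin k) ≃L[ℝ] EuclideanSpace ℝ (Fin k)}
    (hA : ∀ x, mahalSq S (A x) = ‖x‖ ^ 2)
    (hA' : ∀ v, multivariateGaussian (A v) S =
        (stdGaussian (EuclideanSpace ℝ (Fin k))).map (fun x ↦ A (v + x)))
    {n : ℕ} {T : (Fin n → EuclideanSpace ℝ (Fin k)) → (Fin n → EuclideanSpace ℝ (Fin k))}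
    (hT : Measurable T) (θ : Fin n → EuclideanSpace ℝ (Fin k)) :
    totalRisk S T (fun i ↦ A (θ i)) =
      ∑ i, ∫⁻ x, ENNReal.ofReal (‖A.symm (T (fun j ↦ A (x j)) i) - θ i‖ ^ 2) ∂shiftedLaw θ := by
  have hlaw : dataLaw S (fun i ↦ A (θ i)) = (shiftedLaw θ).map fun x i ↦ A (x i) := by
    have : ∀ i, IsProbabilityMeasure (((stdGaussian (EuclideanSpace ℝ (Fin k))).map
        fun x ↦ θ i + x).map A) := fun i ↦ Measure.isProbabilityMeasure_map (by fun_prop)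
    rw [shiftedLaw, Measure.pi_map_pi (f := fun _ ↦ A) fun i ↦ by fun_prop, dataLaw]
    congr 1
    funext i
    rw [hA', Measure.map_map (by fun_prop) (by fun_prop)]
    rfl
  have hq := measurable_mahalSq (S := S)
  refine Finset.sum_congr rfl fun i _ ↦ ?_
  have hm : Measurable fun X : Fin n → EuclideanSpace ℝ (Fin k) ↦
      ENNReal.ofReal (mahalSq S (T X i - A (θ i))) :=
    (hq.comp (((measurable_pi_apply i).comp hT).sub_const _)).ennreal_ofReal
  rw [coordRisk, hlaw, lintegral_map hm (by fun_prop)]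
  refine lintegral_congr fun x ↦ ?_
  rw [← hA, map_sub, A.apply_symm_apply]

theorem minimaxRisk_ge (hk : 0 < k) (hS : S.PosDef) {n q m : ℕ} (hm : 0 < m) (hqm : q * m ≤ n)
    {a : ℝ} (ha : 0 < a) (g t : ℝ) :
    q * ENNReal.ofReal (a ^ 2) ≤
      minimaxRisk S n q + q * (ENNReal.ofReal (a ^ 2) * spikeBound a g t m) := by
  obtain ⟨A, hA, hA'⟩ := exists_whitening hS
  let e : Fin q × Fin m ↪ Fin n :=
    finProdFinEquiv.toEmbedding.trans (Fin.castLEEmb hqm)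
  set u : EuclideanSpace ℝ (Fin k) := EuclideanSpace.single ⟨0, hk⟩ 1 with hu'
  have hu : ‖u‖ = 1 := by simp [hu']
  -- The error term is moved to the left so that the right side is the bare infimum over estimators.
  rw [← tsub_le_iff_right]
  refine le_iInf₂ fun T hT ↦ ?_
  rw [tsub_le_iff_right]
  have hT' : Measurable fun (x : Fin n → EuclideanSpace ℝ (Fin k)) i ↦
      A.symm (T (fun j ↦ A (x j)) i) := by
    refine measurable_pi_lambda _ fun i ↦ A.symm.continuous.measurable.comp
      ((measurable_pi_apply i).comp (hT.comp (by fun_prop)))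
  refine (minimax_spikeConfig_ge hm e hu ha g t hT').trans ?_
  gcongr
  refine iSup_le fun I ↦ ?_
  rw [← totalRisk_map hA hA' hT]
  refine le_iSup₂ (f := fun θ (_ : θ ∈ nearlyBlack k n q) ↦ totalRisk S T θ)
    (fun i ↦ A (spikeConfig e (a • u) I i)) ?_
  have hsub : {i | A (spikeConfig e (a • u) I i) ≠ 0} ⊆ Set.range fun b ↦ e (b, I b) := by
    intro j hj
    by_cases h : ∃ p, e p = j
    · obtain ⟨⟨b, i⟩, rfl⟩ := h
      have hj : A (spikeConfig e (a • u) I (e (b, i))) ≠ 0 := hj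
      rw [spikeConfig, e.injective.extend_apply] at hj
      by_cases hi : i = I b
      · exact ⟨b, by simp [hi]⟩
      · simp [hi] at hj
    · have hj : A (spikeConfig e (a • u) I j) ≠ 0 := hj
      rw [spikeConfig, Function.extend_apply' _ _ _ h] at hj
      simp at hj
  change {i | A (spikeConfig e (a • u) I i) ≠ 0}.ncard ≤ q
  refine (Set.ncard_le_ncard hsub (Set.toFinite _)).trans ?_
  rw [← Set.image_univ]
  refine (Set.ncard_image_le Set.finite_univ).trans ?_
  simp [Set.ncard_univ]

/-- On `[t, t + 1]` the density is at least its value at `t + 1`. -/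
theorem le_gaussianReal_Ici {t : ℝ} (ht : 0 ≤ t) :
    ENNReal.ofReal ((Real.sqrt (2 * Real.pi))⁻¹ * Real.exp (-(t + 1) ^ 2 / 2)) ≤
      gaussianReal 0 1 (Set.Ici t) := by
  rw [gaussianReal_apply 0 one_ne_zero]
  calc ENNReal.ofReal ((Real.sqrt (2 * Real.pi))⁻¹ * Real.exp (-(t + 1) ^ 2 / 2))
      = ∫⁻ _ in Set.Icc t (t + 1),
        ENNReal.ofReal ((Real.sqrt (2 * Real.pi))⁻¹ * Real.exp (-(t + 1) ^ 2 / 2)) := by simp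
    _ ≤ ∫⁻ x in Set.Icc t (t + 1), gaussianPDF 0 1 x := by
        refine setLIntegral_mono (by fun_prop) fun x hx ↦ ENNReal.ofReal_le_ofReal ?_
        rw [gaussianPDFReal]
        simp only [NNReal.coe_one, mul_one, sub_zero]
        gcongr
        · linarith [hx.1]
        · exact hx.2
    _ ≤ _ := lintegral_mono_set fun x hx ↦ hx.1

theorem gaussianReal_Iio_pow_le {t : ℝ} (ht : 0 ≤ t) (j : ℕ) :
    gaussianReal 0 1 (Set.Iio t) ^ j ≤ ENNReal.ofReal (Real.exp
      (-(j * ((Real.sqrt (2 * Real.pi))⁻¹ * Real.exp (-(t + 1) ^ 2 / 2))))) := by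
  set p := (Real.sqrt (2 * Real.pi))⁻¹ * Real.exp (-(t + 1) ^ 2 / 2) with hp
  have h : gaussianReal 0 1 (Set.Iio t) ≤ ENNReal.ofReal (Real.exp (-p)) := by
    rw [← Set.compl_Ici, prob_compl_eq_one_sub measurableSet_Ici]
    calc 1 - gaussianReal 0 1 (Set.Ici t) ≤ 1 - ENNReal.ofReal p :=
          tsub_le_tsub_left (le_gaussianReal_Ici ht) 1
      _ = ENNReal.ofReal (1 - p) := by
          rw [ENNReal.ofReal_sub _ (by positivity), ENNReal.ofReal_one]
      _ ≤ _ := ENNReal.ofReal_le_ofReal (by linarith [Real.add_one_le_exp (-p)])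
  calc gaussianReal 0 1 (Set.Iio t) ^ j ≤ ENNReal.ofReal (Real.exp (-p)) ^ j := by gcongr
    _ = _ := by
        rw [← ENNReal.ofReal_pow (Real.exp_pos _).le, ← Real.exp_nat_mul]
        congr 2
        ring

theorem tendsto_gaussianReal_Ici : Tendsto (fun g ↦ gaussianReal 0 1 (Set.Ici g)) atTop (𝓝 0) := by
  have h := tendsto_measure_iInter_atTop (μ := gaussianReal 0 1) (s := fun g : ℝ ↦ Set.Ici g)
    (fun g ↦ measurableSet_Ici.nullMeasurableSet) (fun a b hab ↦ Set.Ici_subset_Ici.2 hab)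
    ⟨0, measure_ne_top _ _⟩
  have he : ⋂ g : ℝ, Set.Ici g = ∅ := by
    ext x
    simp only [Set.mem_iInter, Set.mem_Ici, Set.mem_empty_iff_false, iff_false, not_forall, not_le]
    exact ⟨x + 1, by linarith⟩
  rwa [he, measure_empty] at h

theorem tendsto_sqrt_two_mul_log :
    Tendsto (fun m : ℕ ↦ Real.sqrt (2 * Real.log m)) atTop atTop :=
  Real.tendsto_sqrt_atTop.comp
    ((Real.tendsto_log_atTop.comp tendsto_natCast_atTop_atTop).const_mul_atTop two_pos)

/-- With `Λ = √(2 log m)`, the level `t` lies midway between `a = αΛ` and `Λ`, and `g` is half of `t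
- a`, so `a(a+g-t) = -α(1-α)Λ²/4` tends to `-∞`. Since `t/Λ < 1`, the expected number of competitors
above `t` grows like a power of `m`. -/
theorem tendsto_spikeBound {α : ℝ} (hα0 : 0 < α) (hα1 : α < 1) :
    Tendsto (fun m : ℕ ↦ spikeBound (α * Real.sqrt (2 * Real.log m))
      ((1 - α) / 4 * Real.sqrt (2 * Real.log m)) ((1 + α) / 2 * Real.sqrt (2 * Real.log m)) m)
      atTop (𝓝 0) := by
  have hΛ := tendsto_sqrt_two_mul_log
  have h1 : Tendsto (fun m : ℕ ↦ gaussianReal 0 1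
      (Set.Ici ((1 - α) / 4 * Real.sqrt (2 * Real.log m)))) atTop (𝓝 0) :=
    tendsto_gaussianReal_Ici.comp (hΛ.const_mul_atTop (by linarith))
  have h3 : Tendsto (fun m : ℕ ↦ ENNReal.ofReal (Real.exp (α * Real.sqrt (2 * Real.log m) *
      (α * Real.sqrt (2 * Real.log m) + (1 - α) / 4 * Real.sqrt (2 * Real.log m) -
        (1 + α) / 2 * Real.sqrt (2 * Real.log m))))) atTop (𝓝 0) := by
    rw [← ENNReal.ofReal_zero]
    refine ENNReal.tendsto_ofReal (Real.tendsto_exp_atBot.comp ?_)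
    have : Tendsto (fun m : ℕ ↦ (-(α * ((1 - α) / 4))) * (Real.sqrt (2 * Real.log m) *
        Real.sqrt (2 * Real.log m))) atTop atBot :=
      (hΛ.atTop_mul_atTop₀ hΛ).const_mul_atTop_of_neg (by nlinarith)
    refine this.congr fun m ↦ by ring
  have h2 : Tendsto (fun m : ℕ ↦ gaussianReal 0 1
      (Set.Iio ((1 + α) / 2 * Real.sqrt (2 * Real.log m))) ^ (m - 1)) atTop (𝓝 0) := by
    set β : ℝ := (1 + α) / 2 with hβ
    have hβ0 : 0 < β := by linarith
    have hβ1 : β < 1 := by linarith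
    have hββ : β ^ 2 < 1 := by nlinarith
    set ρ : ℝ := (1 + β ^ 2) / 2 with hρ
    have hρ1 : 0 < 1 - ρ := by linarith
    -- Chosen so that `(1 + x) β² = ρ < 1`: the shift in `(t + 1)²` is absorbed at the cost of
    -- raising the exponent from `β²` to `ρ`.
    set x : ℝ := (1 - β ^ 2) / (2 * β ^ 2) with hx
    have hx0 : 0 < x := by
      have : 0 < 1 - β ^ 2 := by linarith
      positivity
    set C : ℝ := (Real.sqrt (2 * Real.pi))⁻¹ * Real.exp (-((1 + x⁻¹) / 2)) / 2 with hC
    have hC0 : 0 < C := by positivity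
    have hlim : Tendsto (fun m : ℕ ↦ ENNReal.ofReal (Real.exp (-(C * (m : ℝ) ^ (1 - ρ)))))
        atTop (𝓝 0) := by
      rw [← ENNReal.ofReal_zero]
      refine ENNReal.tendsto_ofReal (Real.tendsto_exp_atBot.comp (tendsto_neg_atTop_atBot.comp ?_))
      exact ((tendsto_rpow_atTop hρ1).comp tendsto_natCast_atTop_atTop).const_mul_atTop hC0
    refine tendsto_of_tendsto_of_tendsto_of_le_of_le' tendsto_const_nhds hlim
      (Eventually.of_forall fun _ ↦ by positivity) ?_
    filter_upwards [eventually_ge_atTop 2] with m hm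
    have hm2 : (2 : ℝ) ≤ m := by exact_mod_cast hm
    have hm0 : (0 : ℝ) < m := by linarith
    have hlog : 0 ≤ Real.log m := Real.log_nonneg (by linarith)
    refine (gaussianReal_Iio_pow_le (by positivity) _).trans (ENNReal.ofReal_le_ofReal ?_)
    refine Real.exp_le_exp.2 (neg_le_neg ?_)
    set t := β * Real.sqrt (2 * Real.log m) with ht
    have ht2 : t ^ 2 = β ^ 2 * (2 * Real.log m) := by
      rw [ht, mul_pow, Real.sq_sqrt (by positivity)]
    have hsq : (t + 1) ^ 2 ≤ (1 + x) * t ^ 2 + (1 + x⁻¹) := by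
      have e : (1 + x) * t ^ 2 + (1 + x⁻¹) - (t + 1) ^ 2 = (x * t - 1) ^ 2 / x := by
        field_simp; ring
      have : 0 ≤ (x * t - 1) ^ 2 / x := by positivity
      linarith
    have hxβ : (1 + x) * β ^ 2 = ρ := by
      rw [hx, hρ]; field_simp; ring
    have hexp : Real.exp (-((1 + x⁻¹) / 2)) * (m : ℝ) ^ (-ρ) ≤ Real.exp (-(t + 1) ^ 2 / 2) := by
      rw [Real.rpow_def_of_pos hm0, ← Real.exp_add]
      refine Real.exp_le_exp.2 ?_
      rw [ht2] at hsq
      have : (1 + x) * (β ^ 2 * (2 * Real.log m)) = 2 * (Real.log m * ρ) := by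
        rw [← hxβ]; ring
      linarith
    have hm1 : (m : ℝ) / 2 ≤ ((m - 1 : ℕ) : ℝ) := by
      rw [Nat.cast_sub (by omega)]
      push_cast
      linarith
    calc C * (m : ℝ) ^ (1 - ρ) = m / 2 * ((Real.sqrt (2 * Real.pi))⁻¹ *
          (Real.exp (-((1 + x⁻¹) / 2)) * (m : ℝ) ^ (-ρ))) := by
          rw [hC, sub_eq_add_neg, Real.rpow_add hm0, Real.rpow_one]
          ring
      _ ≤ _ := by gcongr
  have := (h1.add h2).add h3
  simpa [spikeBound] using this

end MinimaxLower

end SparseNormalMeans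

namespace SparseNormalMeans

/-! ### Substitution of the tuning sequence and passage to the limit. -/

section Asymptotics

variable {k : ℕ} {S : Matrix (Fin k) (Fin k) ℝ} {d : ℝ} {q : ℕ → ℕ}

theorem tendsto_div_atTop (hq : ∀ᶠ n in atTop, 0 < q n)
    (hqn : Tendsto (fun n : ℕ ↦ (q n : ℝ) / n) atTop (𝓝 0)) :
    Tendsto (fun n : ℕ ↦ (n : ℝ) / q n) atTop atTop := by
  have h : Tendsto (fun n : ℕ ↦ (q n : ℝ) / n) atTop (𝓝[>] 0) := by
    refine tendsto_nhdsWithin_iff.2 ⟨hqn, ?_⟩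
    filter_upwards [hq, eventually_gt_atTop 0] with n h1 h2
    have : (0 : ℝ) < q n := by exact_mod_cast h1
    have : (0 : ℝ) < n := by exact_mod_cast h2
    exact Set.mem_Ioi.2 (by positivity)
  refine h.inv_tendsto_nhdsGT_zero.congr fun n ↦ ?_
  simp

theorem tendsto_log_div_atTop (hq : ∀ᶠ n in atTop, 0 < q n)
    (hqn : Tendsto (fun n : ℕ ↦ (q n : ℝ) / n) atTop (𝓝 0)) :
    Tendsto (fun n : ℕ ↦ Real.log ((n : ℝ) / q n)) atTop atTop :=
  Real.tendsto_log_atTop.comp (tendsto_div_atTop hq hqn)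

section Tuning

variable {n q : ℕ}

theorem tuningScale_pos (hq : 0 < q) (hn : 0 < n) : 0 < tuningScale d n q := by
  have : (0 : ℝ) < q := by exact_mod_cast hq
  have : (0 : ℝ) < n := by exact_mod_cast hn
  unfold tuningScale
  positivity

theorem log_tuningScale (hd : 0 < d) (hq : 0 < q) (hn : 0 < n) :
    -(d * Real.log (tuningScale d n q)) = (1 + tuningEps n q) * Real.log ((n : ℝ) / q) := by
  have h1 : (0 : ℝ) < q := by exact_mod_cast hq
  have h2 : (0 : ℝ) < n := by exact_mod_cast hn
  rw [tuningScale, Real.log_rpow (by positivity), ← inv_div (n : ℝ) q, Real.log_inv]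
  field_simp

theorem tuningScale_rpow (hd : 0 < d) (hq : 0 < q) (hn : 0 < n) :
    tuningScale d n q ^ d =
      Real.exp (-((1 + tuningEps n q) * Real.log ((n : ℝ) / q))) := by
  rw [Real.rpow_def_of_pos (tuningScale_pos hq hn), ← log_tuningScale hd hq hn, neg_neg, mul_comm]

theorem tuningScale_le_one (hd : 0 < d) (hq : 0 < q) (hn : 0 < n)
    (hL : 1 ≤ Real.log ((n : ℝ) / q)) : tuningScale d n q ≤ 1 := by
  have hc := tuningScale_pos (d := d) hq hn
  have h := log_tuningScale hd hq hn
  have he : 0 ≤ tuningEps n q := div_nonneg zero_le_one (Real.log_nonneg hL)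
  have : 0 ≤ (1 + tuningEps n q) * Real.log ((n : ℝ) / q) := by positivity
  rw [← Real.log_nonpos_iff hc.le]
  by_contra! h'
  nlinarith

end Tuning

/-- The exponential is `(q/n)^ε` with `ε = 1/log L`. It beats every power of `L` because `(log L)² =
o(L)`; the correction `ε` in the tuning sequence serves to cancel the polynomial factor in the risk
at zero. -/
theorem eventually_exp_mul_rpow_le_one (p : ℝ) :
    ∀ᶠ L : ℝ in atTop, Real.exp (-(1 / Real.log L * L)) * (4 * L) ^ p ≤ 1 := by
  have h := (Real.isLittleO_pow_log_id_atTop (n := 2)).bound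
    (show (0 : ℝ) < 1 / (2 * (|p| + 1)) by positivity)
  filter_upwards [h, eventually_ge_atTop 4] with L hL hL4
  have hL0 : 0 < L := by linarith
  have hlog : 0 < Real.log L := Real.log_pos (by linarith)
  rw [Real.norm_of_nonneg (by positivity), id, Real.norm_of_nonneg hL0.le, div_mul_eq_mul_div,
    one_mul, le_div_iff₀ (by positivity)] at hL
  rw [Real.rpow_def_of_pos (by positivity), ← Real.exp_add, Real.exp_le_one_iff,
    Real.log_mul (by norm_num) hL0.ne']
  have h4 : Real.log 4 ≤ Real.log L := Real.log_le_log (by norm_num) hL4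
  have h40 : 0 ≤ Real.log 4 := Real.log_nonneg (by norm_num)
  have h5 : (Real.log 4 + Real.log L) * p ≤ 2 * Real.log L * |p| := by
    have := le_abs_self p
    have := abs_nonneg p
    nlinarith
  have h6 : 2 * Real.log L * |p| ≤ 1 / Real.log L * L := by
    rw [one_div_mul_eq_div, le_div_iff₀ hlog]
    nlinarith [abs_nonneg p]
  linarith

theorem eventually_zeroRisk_le (hS : S.PosDef) (hd : 0 < d) (hd1 : d < 1)
    (hq : ∀ᶠ n in atTop, 0 < q n)
    (hqn : Tendsto (fun n : ℕ ↦ (q n : ℝ) / n) atTop (𝓝 0)) {b : ℝ} (hb : 0 < b) :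
    ∀ᶠ n : ℕ in atTop, (⨆ θ ∈ nearlyBlack k n (q n),
      zeroRisk S (eigEstimator S d (tuningScale d n (q n)) n) θ) ≤
        ENNReal.ofReal (b * (q n * Real.log ((n : ℝ) / q n))) := by
  obtain ⟨C, hC, h⟩ := exists_zeroRisk_le hS hd hd1
  have hL := tendsto_log_div_atTop hq hqn
  filter_upwards [hq, eventually_gt_atTop 0, hL.eventually_ge_atTop 1,
    hL.eventually_ge_atTop (2 * C / b),
    hL.eventually (eventually_exp_mul_rpow_le_one (k / 2 + 1))] with n hq0 hn0 hL1 hLb hLp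
  refine iSup₂_le fun θ _ ↦ ?_
  set L := Real.log ((n : ℝ) / q n) with hLdef
  have hq1 : (0 : ℝ) < q n := by exact_mod_cast hq0
  have hn1 : (0 : ℝ) < n := by exact_mod_cast hn0
  -- The cut-off `M = 4L` makes `e^(-M/4)` equal to `q/n`.
  refine (h _ (4 * L) (tuningScale_pos hq0 hn0) (tuningScale_le_one hd hq0 hn0 hL1) (by linarith)
    n θ).trans (ENNReal.ofReal_le_ofReal ?_)
  have heL : n * Real.exp (-L) = q n := by
    rw [Real.exp_neg, hLdef, Real.exp_log (by positivity)]
    field_simp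
  have hcd : tuningScale d n (q n) ^ d = Real.exp (-L) * Real.exp (-(1 / Real.log L * L)) := by
    rw [tuningScale_rpow hd hq0 hn0, ← Real.exp_add, tuningEps, ← hLdef]
    congr 1
    ring
  rw [hcd, show -(4 * L) / 4 = -L by ring]
  rw [div_le_iff₀ hb] at hLb
  calc n * (C * (Real.exp (-L) * Real.exp (-(1 / Real.log L * L)) * (4 * L) ^ (k / 2 + 1 : ℝ) +
        Real.exp (-L)))
      = (n * Real.exp (-L)) * (C * (Real.exp (-(1 / Real.log L * L)) *
        (4 * L) ^ (k / 2 + 1 : ℝ) + 1)) := by ring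
    _ ≤ q n * (C * (1 + 1)) := by
        rw [heL]
        gcongr
    _ ≤ q n * (b * L) := by
        refine mul_le_mul_of_nonneg_left ?_ hq1.le
        linarith
    _ = _ := by ring

theorem eventually_nonzeroRisk_le (hS : S.PosDef) (hd : 0 < d)
    (hq : ∀ᶠ n in atTop, 0 < q n)
    (hqn : Tendsto (fun n : ℕ ↦ (q n : ℝ) / n) atTop (𝓝 0)) {b : ℝ} (hb : 1 < b) :
    ∀ᶠ n : ℕ in atTop, (⨆ θ ∈ nearlyBlack k n (q n),
      nonzeroRisk S (eigEstimator S d (tuningScale d n (q n)) n) θ) ≤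
        ENNReal.ofReal (b * (2 * q n * Real.log ((n : ℝ) / q n))) := by
  -- Three factors `1 + δ` come from the risk bound, the fourth dominates `1 + ε`.
  obtain ⟨δ, hδ, hδ0⟩ : ∃ δ : ℝ, (1 + δ) ^ 4 < b ∧ 0 < δ := by
    have hcont : Tendsto (fun δ : ℝ ↦ (1 + δ) ^ 4) (𝓝[>] 0) (𝓝 1) := by
      have : Tendsto (fun δ : ℝ ↦ (1 + δ) ^ 4) (𝓝 0) (𝓝 ((1 + 0) ^ 4)) :=
        Continuous.tendsto (by fun_prop) 0
      exact (by simpa using this : Tendsto (fun δ : ℝ ↦ (1 + δ) ^ 4) (𝓝 0) (𝓝 1)).mono_left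
        nhdsWithin_le_nhds
    exact ((hcont.eventually_lt_const hb).and self_mem_nhdsWithin).exists
  obtain ⟨C, hC, h⟩ := exists_nonzeroRisk_le hS hd hδ0
  have hL := tendsto_log_div_atTop hq hqn
  have heps : Tendsto (fun n : ℕ ↦ tuningEps n (q n)) atTop (𝓝 0) :=
    (Real.tendsto_log_atTop.comp hL).const_div_atTop 1
  have hgap : 0 < 2 * (b - (1 + δ) ^ 4) := by linarith
  filter_upwards [hq, eventually_gt_atTop 0, hL.eventually_ge_atTop 1,
    hL.eventually_ge_atTop (C / (2 * (b - (1 + δ) ^ 4))), heps.eventually_lt_const hδ0]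
    with n hq0 hn0 hL1 hLb he
  refine iSup₂_le fun θ hθ ↦ ?_
  refine (h _ (tuningScale_pos hq0 hn0) (tuningScale_le_one hd hq0 hn0 hL1)
    n (q n) θ hθ).trans (ENNReal.ofReal_le_ofReal ?_)
  rw [log_tuningScale hd hq0 hn0]
  set L := Real.log ((n : ℝ) / q n) with hLdef
  rw [div_le_iff₀ hgap] at hLb
  have h1 : 2 * (1 + δ) ^ 3 * ((1 + tuningEps n (q n)) * L) ≤
      2 * (1 + δ) ^ 3 * ((1 + δ) * L) := by gcongr
  calc q n * (C + 2 * (1 + δ) ^ 3 * ((1 + tuningEps n (q n)) * L)) ≤ q n * (b * (2 * L)) := by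
        gcongr
        nlinarith
    _ = _ := by ring

theorem eventually_totalRisk_le (hS : S.PosDef) (hd : 0 < d) (hd1 : d < 1)
    (hq : ∀ᶠ n in atTop, 0 < q n)
    (hqn : Tendsto (fun n : ℕ ↦ (q n : ℝ) / n) atTop (𝓝 0)) {b : ℝ} (hb : 1 < b) :
    ∀ᶠ n : ℕ in atTop, (⨆ θ ∈ nearlyBlack k n (q n),
      totalRisk S (eigEstimator S d (tuningScale d n (q n)) n) θ) ≤
        ENNReal.ofReal (b * (2 * q n * Real.log ((n : ℝ) / q n))) := by
  -- The zero part is measured against `q L` and the nonzero part against `2 q L`: `(b - 1) + 2 *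
  -- ((b + 1)/2) = 2b`.
  filter_upwards [eventually_zeroRisk_le (k := k) hS hd hd1 hq hqn (show 0 < b - 1 by linarith),
    eventually_nonzeroRisk_le (k := k) hS hd hq hqn (show 1 < (b + 1) / 2 by linarith),
    (tendsto_log_div_atTop hq hqn).eventually_ge_atTop 0] with n h1 h2 hL
  refine iSup₂_le fun θ hθ ↦ ?_
  rw [totalRisk_eq_add]
  refine (add_le_add ((le_iSup₂ (f := fun θ (_ : θ ∈ nearlyBlack k n (q n)) ↦ zeroRisk S
    (eigEstimator S d (tuningScale d n (q n)) n) θ) θ hθ).trans h1)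
    ((le_iSup₂ (f := fun θ (_ : θ ∈ nearlyBlack k n (q n)) ↦ nonzeroRisk S
    (eigEstimator S d (tuningScale d n (q n)) n) θ) θ hθ).trans h2)).trans ?_
  have : 0 ≤ b - 1 := by linarith
  rw [← ENNReal.ofReal_add (by positivity) (by positivity)]
  refine le_of_eq (congrArg _ ?_)
  ring

theorem minimaxRisk_le_totalRisk (hS : S.PosDef) (hd : 0 < d) {n q : ℕ} (hq : 0 < q) (hn : 0 < n) :
    minimaxRisk S n q ≤ ⨆ θ ∈ nearlyBlack k n q,
      totalRisk S (eigEstimator S d (tuningScale d n q) n) θ :=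
  iInf₂_le _ (measurable_eigEstimator hS hd (tuningScale_pos hq hn) n)

theorem eventually_minimaxRisk_ge (hk : 0 < k) (hS : S.PosDef)
    (hq : ∀ᶠ n in atTop, 0 < q n)
    (hqn : Tendsto (fun n : ℕ ↦ (q n : ℝ) / n) atTop (𝓝 0)) {b : ℝ} (hb0 : 0 < b) (hb1 : b < 1) :
    ∀ᶠ n : ℕ in atTop, ENNReal.ofReal (b * (2 * q n * Real.log ((n : ℝ) / q n))) ≤
      minimaxRisk S n (q n) := by
  -- One factor `β` is spent on each of three losses: `α² = β`, `log m ≥ β L`, and one minus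
  -- `spikeBound` at least `β`.
  set β : ℝ := b ^ (1 / 3 : ℝ) with hβ
  have hβ0 : 0 < β := by positivity
  have hβ1 : β < 1 := Real.rpow_lt_one hb0.le hb1 (by norm_num)
  have hβ3 : β * β * β = b := by
    rw [hβ, ← Real.rpow_add hb0, ← Real.rpow_add hb0]; norm_num
  set α : ℝ := Real.sqrt β with hα
  have hα0 : 0 < α := by positivity
  have hα1 : α < 1 := by rw [hα, Real.sqrt_lt' one_pos]; simpa using hβ1
  have hα2 : α ^ 2 = β := Real.sq_sqrt hβ0.le
  have hr := tendsto_div_atTop hq hqn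
  have hL := tendsto_log_div_atTop hq hqn
  have hm : Tendsto (fun n ↦ n / q n) atTop atTop := by
    refine tendsto_natCast_atTop_iff (R := ℝ).1 (tendsto_atTop_mono' atTop ?_
      (tendsto_atTop_add_const_right atTop (-1) hr))
    filter_upwards [hq] with n hq0
    have hq1 : (0 : ℝ) < q n := by exact_mod_cast hq0
    have : (n : ℝ) < q n * ((n / q n : ℕ) + 1) := by
      exact_mod_cast Nat.lt_mul_div_succ n hq0
    have : (n : ℝ) / q n < (n / q n : ℕ) + 1 := by
      rw [div_lt_iff₀ hq1]; linarith
    linarith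
  have hη := ((tendsto_spikeBound hα0 hα1).comp hm).eventually_lt_const
    (show (0 : ℝ≥0∞) < ENNReal.ofReal (1 - β) by simpa using hβ1)
  have hgap : 0 < 1 - β := by linarith
  filter_upwards [hq, hr.eventually_ge_atTop 2, hm.eventually_ge_atTop 2, hη,
    hL.eventually_ge_atTop (Real.log 2 / (1 - β))] with n hq0 hr2 hm2 hη hLb
  have hq1 : (0 : ℝ) < q n := by exact_mod_cast hq0
  set m := n / q n with hmdef
  set L := Real.log ((n : ℝ) / q n) with hLdef
  have hm1 : (2 : ℝ) ≤ m := by exact_mod_cast hm2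
  -- Rounding `n/q` down loses at most a factor `2`, and `log 2 ≤ (1 - β) L` eventually.
  have hlogm : β * L ≤ Real.log m := by
    have h1 : (n : ℝ) < q n * (m + 1) := by exact_mod_cast Nat.lt_mul_div_succ n hq0
    have h2 : (n : ℝ) / q n / 2 ≤ m := by
      have : (n : ℝ) / q n < m + 1 := by
        rw [div_lt_iff₀ hq1]; linarith
      linarith
    have h3 := Real.log_le_log (by positivity) h2
    rw [Real.log_div (by positivity) (by norm_num), ← hLdef] at h3
    rw [div_le_iff₀ hgap] at hLb
    linarith
  have hlog0 : 0 < Real.log m := Real.log_pos (by linarith)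
  set a := α * Real.sqrt (2 * Real.log m) with ha
  have ha2 : a ^ 2 = β * (2 * Real.log m) := by
    rw [ha, mul_pow, hα2, Real.sq_sqrt (by positivity)]
  have h := minimaxRisk_ge hk hS (n := n) (q := q n) (m := m) (by omega) (Nat.mul_div_le n (q n))
    (a := a) (by positivity) ((1 - α) / 4 * Real.sqrt (2 * Real.log m))
    ((1 + α) / 2 * Real.sqrt (2 * Real.log m))
  have h2 : ENNReal.ofReal (q n * (a ^ 2 * β)) + ENNReal.ofReal (q n * (a ^ 2 * (1 - β))) ≤
      minimaxRisk S n (q n) + ENNReal.ofReal (q n * (a ^ 2 * (1 - β))) := by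
    rw [← ENNReal.ofReal_add (by positivity) (by positivity),
      show q n * (a ^ 2 * β) + q n * (a ^ 2 * (1 - β)) = q n * a ^ 2 by ring,
      ENNReal.ofReal_mul hq1.le, ENNReal.ofReal_natCast]
    refine h.trans ?_
    rw [ENNReal.ofReal_mul hq1.le, ENNReal.ofReal_mul (sq_nonneg a), ENNReal.ofReal_natCast]
    gcongr
    exact hη.le
  refine le_trans (ENNReal.ofReal_le_ofReal ?_)
    ((ENNReal.add_le_add_iff_right ENNReal.ofReal_ne_top).1 h2)
  rw [ha2, ← hβ3]
  calc β * β * β * (2 * q n * L) = q n * (β * (2 * (β * L)) * β) := by ring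
    _ ≤ _ := by gcongr

theorem tendsto_one_of_eventually_bounds {f : ℕ → ℝ≥0∞}
    (hu : ∀ b : ℝ, 1 < b → ∀ᶠ n in atTop, f n ≤ ENNReal.ofReal b)
    (hl : ∀ b : ℝ, 0 < b → b < 1 → ∀ᶠ n in atTop, ENNReal.ofReal b ≤ f n) :
    Tendsto f atTop (𝓝 1) := by
  refine tendsto_order.2 ⟨fun x hx ↦ ?_, fun x hx ↦ ?_⟩
  · obtain ⟨y, hxy, hy1⟩ := exists_between hx
    have hyt : y ≠ ∞ := hy1.ne_top
    have hy0 : 0 < y.toReal := ENNReal.toReal_pos (bot_lt_of_lt hxy).ne' hyt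
    filter_upwards [hl y.toReal hy0 (by
      rw [← ENNReal.toReal_one]; exact (ENNReal.toReal_lt_toReal hyt ENNReal.one_ne_top).2 hy1)]
      with n hn
    rw [ENNReal.ofReal_toReal hyt] at hn
    exact hxy.trans_le hn
  · obtain ⟨y, hy1, hyx⟩ := exists_between hx
    have hyt : y ≠ ∞ := hyx.ne_top
    filter_upwards [hu y.toReal (by
      rw [← ENNReal.toReal_one]; exact (ENNReal.toReal_lt_toReal ENNReal.one_ne_top hyt).2 hy1)]
      with n hn
    rw [ENNReal.ofReal_toReal hyt] at hn
    exact hn.trans_lt hyx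

end Asymptotics

end SparseNormalMeans

/-! ### The four limits. -/

theorem theorem4 (k : ℕ) (hk : 0 < k) (S : Matrix (Fin k) (Fin k) ℝ) (hS : S.PosDef)
    (d : ℝ) (hd0 : 0 < d) (hd1 : d < 1)
    (q : ℕ → ℕ) (hq : ∀ᶠ n in atTop, 0 < q n)
    (hqn : Tendsto (fun n : ℕ ↦ (q n : ℝ) / n) atTop (𝓝 0)) :
    Tendsto (fun n : ℕ ↦
        (⨆ θ ∈ nearlyBlack k n (q n),
          zeroRisk S (eigEstimator S d (tuningScale d n (q n)) n) θ) /
        ENNReal.ofReal (q n * Real.log ((n : ℝ) / q n))) atTop (𝓝 0) ∧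
    limsup (fun n : ℕ ↦
        (⨆ θ ∈ nearlyBlack k n (q n),
          nonzeroRisk S (eigEstimator S d (tuningScale d n (q n)) n) θ) /
        ENNReal.ofReal (2 * q n * Real.log ((n : ℝ) / q n))) atTop ≤ 1 ∧
    Tendsto (fun n : ℕ ↦
        (⨆ θ ∈ nearlyBlack k n (q n),
          totalRisk S (eigEstimator S d (tuningScale d n (q n)) n) θ) /
        ENNReal.ofReal (2 * q n * Real.log ((n : ℝ) / q n))) atTop (𝓝 1) ∧
    Tendsto (fun n : ℕ ↦ minimaxRisk S n (q n) /
        ENNReal.ofReal (2 * q n * Real.log ((n : ℝ) / q n))) atTop (𝓝 1) := by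
  have hL := tendsto_log_div_atTop hq hqn
  have hpos : ∀ᶠ n : ℕ in atTop, 0 < q n ∧ 0 < n ∧ 0 < Real.log ((n : ℝ) / q n) := by
    filter_upwards [hq, eventually_gt_atTop 0, hL.eventually_gt_atTop 0] with n h1 h2 h3
      using ⟨h1, h2, h3⟩
  have hden : ∀ᶠ n : ℕ in atTop, 0 < 2 * q n * Real.log ((n : ℝ) / q n) := by
    filter_upwards [hpos] with n h
    have : (0 : ℝ) < q n := by exact_mod_cast h.1
    have := h.2.2
    positivity
  have div_le : ∀ {f : ℕ → ℝ≥0∞} {g : ℕ → ℝ} {b : ℝ}, 0 ≤ b →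
      (∀ᶠ n in atTop, f n ≤ ENNReal.ofReal (b * g n)) →
      ∀ᶠ n in atTop, f n / ENNReal.ofReal (g n) ≤ ENNReal.ofReal b := by
    intro f g b hb h
    filter_upwards [h] with n h
    refine ENNReal.div_le_of_le_mul ?_
    rwa [← ENNReal.ofReal_mul hb]
  have le_div : ∀ {f : ℕ → ℝ≥0∞} {b : ℝ}, 0 ≤ b →
      (∀ᶠ n : ℕ in atTop,
        ENNReal.ofReal (b * (2 * q n * Real.log ((n : ℝ) / q n))) ≤ f n) →
      ∀ᶠ n : ℕ in atTop, ENNReal.ofReal b ≤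
        f n / ENNReal.ofReal (2 * q n * Real.log ((n : ℝ) / q n)) := by
    intro f b hb h
    filter_upwards [h, hden] with n h h0
    rw [ENNReal.le_div_iff_mul_le (Or.inl (ENNReal.ofReal_pos.2 h0).ne')
      (Or.inl ENNReal.ofReal_ne_top), ← ENNReal.ofReal_mul hb]
    exact h
  have hminimax : ∀ᶠ n : ℕ in atTop, minimaxRisk S n (q n) ≤ ⨆ θ ∈ nearlyBlack k n (q n),
      totalRisk S (eigEstimator S d (tuningScale d n (q n)) n) θ := by
    filter_upwards [hpos] with n h using minimaxRisk_le_totalRisk hS hd0 h.1 h.2.1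
  refine ⟨?_, ?_, ?_, ?_⟩
  · refine ENNReal.tendsto_nhds_zero.2 fun x hx ↦ ?_
    obtain ⟨y, hy0, hyx⟩ := exists_between hx
    have hyt : y ≠ ∞ := hyx.ne_top
    have hy : 0 < y.toReal := ENNReal.toReal_pos hy0.ne' hyt
    filter_upwards [div_le hy.le (eventually_zeroRisk_le hS hd0 hd1 hq hqn hy)] with n hn
    rw [ENNReal.ofReal_toReal hyt] at hn
    exact hn.trans hyx.le
  · refine le_of_forall_gt fun x hx ↦ ?_
    obtain ⟨y, hy1, hyx⟩ := exists_between hx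
    have hyt : y ≠ ∞ := hyx.ne_top
    have hy : 1 < y.toReal := by
      rw [← ENNReal.toReal_one]
      exact (ENNReal.toReal_lt_toReal ENNReal.one_ne_top hyt).2 hy1
    refine lt_of_le_of_lt (limsup_le_of_le (h := ?_)) hyx
    filter_upwards [div_le (by linarith) (eventually_nonzeroRisk_le hS hd0 hq hqn hy)] with n hn
    rwa [ENNReal.ofReal_toReal hyt] at hn
  -- The lower bound for this particular estimator is the minimax lower bound.
  · refine tendsto_one_of_eventually_bounds
      (fun b hb ↦ div_le (by linarith) (eventually_totalRisk_le hS hd0 hd1 hq hqn hb))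
      fun b hb0 hb1 ↦ le_div hb0.le ?_
    filter_upwards [eventually_minimaxRisk_ge hk hS hq hqn hb0 hb1, hminimax] with n h1 h2
      using h1.trans h2
  · refine tendsto_one_of_eventually_bounds (fun b hb ↦ div_le (by linarith) ?_)
      fun b hb0 hb1 ↦ le_div hb0.le (eventually_minimaxRisk_ge hk hS hq hqn hb0 hb1)
    filter_upwards [eventually_totalRisk_le hS hd0 hd1 hq hqn hb, hminimax] with n h1 h2
      using h2.trans h1
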